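/- **Setting.** Let $n\ge 1$, $0\le k\le n$, $r\ge 0$. Let $\mathcal T_h$ be a partition of a bounded polyhedral domain $\Omega\subset\mathbb R^n$ into finitely many (at least one) non-overlapping polyhedral cells $K$ with matching planar facets $e\subset\partial K$ (e.g. a simplicial triangulation). Write $W_h^j=\prod_K\mathcal P_r\Lambda^j(K)$ and $\widehat W_h^{j,\mathrm{tan}}=\prod_K\prod_{e\subset\partial K}\mathcal P_r\Lambda^j(e)$; let $\widehat V_h^{j,\mathrm{tan}}\subset\widehat W_h^{j,\mathrm{tan}}$ be the traces that are single-valued on interior facets, and $\mathring{\widehat V}{}_h^{j,\mathrm{tan}}$ those that moreover vanish on $\partial\Omega$. For a form $w$ on $K$, $w^{\mathrm{tan}}=\operatorname{tr}w$ and $w^{\mathrm{nor}}=\widehat\star^{-1}\operatorname{tr}\star w$ on $\partial K$; $(\cdot,\cdot)$ and $\langle\cdot,\cdot\rangle$ are the $L^2$ inner products on cells and on their boundaries. Let $\alpha^{k-1},\alpha^k$ be piecewise-constant penalties: multiplication by a scalar $\alpha_{K,e}$ on each facet $e$ of each $K$. Let $I$ be a nondegenerate time interval and $f=\prod_K f_K$,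 $f_K:I\times W_h^k(K)\to L^2\Lambda^k(K)$, be continuous, $C^1$ in $u$ with $\partial f/\partial u$ continuous in $(t,u)$ and symmetric. **The method**, on a time interval $J\subseteq I$ with initial time $t_0\in J$. Find $\sigma_h,u_h,\rho_h,p_h$ with values in $W_h^{k-1},W_h^k,W_h^{k+1},W_h^k$, and $\widehat\sigma_h^{\mathrm{tan}}\in\widehat V_h^{k-1,\mathrm{tan}}$, $\widehat p_h^{\mathrm{tan}}\in\widehat V_h^{k,\mathrm{tan}}$, with $$\begin{aligned} (\dot\sigma_h,\tau_h)_{\mathcal T_h}+(\delta p_h,\tau_h)_{\mathcal T_h}+\langle\alpha^{k-1}(\widehat\sigma_h^{\mathrm{tan}}-\sigma_h^{\mathrm{tan}}),\tau_h^{\mathrm{tan}}\rangle_{\partial\mathcal T_h}&=0,\\ (\dot u_h,r_h)_{\mathcal T_h}&=(p_h,r_h)_{\mathcal T_h},\\ (\dot\rho_h,\eta_h)_{\mathcal T_h}+(p_h,\delta\eta_h)_{\mathcal T_h}+\langle\widehat p_h^{\mathrm{tan}},\eta_h^{\mathrm{nor}}\rangle_{\partial\mathcal T_h}&=0,\\ -(\dot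 p_h,v_h)_{\mathcal T_h}+(\sigma_h,\delta v_h)_{\mathcal T_h}+(\delta\rho_h,v_h)_{\mathcal T_h}+\langle\widehat\sigma_h^{\mathrm{tan}},v_h^{\mathrm{nor}}\rangle_{\partial\mathcal T_h}+\langle\alpha^k(\widehat p_h^{\mathrm{tan}}-p_h^{\mathrm{tan}}),v_h^{\mathrm{tan}}\rangle_{\partial\mathcal T_h}&=(f(t,u_h),v_h)_{\mathcal T_h},\\ \langle\widehat p_h^{\mathrm{nor}},\widehat\tau_h^{\mathrm{tan}}\rangle_{\partial\mathcal T_h}=0,\qquad\langle\widehat\rho_h^{\mathrm{nor}},\widehat v_h^{\mathrm{tan}}\rangle_{\partial\mathcal T_h}&=0 \end{aligned}$$ for all $\tau_h\in W_h^{k-1}$, $r_h,v_h\in W_h^k$, $\eta_h\in W_h^{k+1}$, $\widehat\tau_h^{\mathrm{tan}}\in\mathring{\widehat V}{}_h^{k-1,\mathrm{tan}}$, $\widehat v_h^{\mathrm{tan}}\in\mathring{\widehat V}{}_h^{k,\mathrm{tan}}$, where $\widehat p_h^{\mathrm{nor}}=p_h^{\mathrm{nor}}-\alpha^{k-1}(\widehat\sigma_h^{\mathrm{tan}}-\sigma_h^{\mathrm{tan}})$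 and $\widehat\rho_h^{\mathrm{nor}}=\rho_h^{\mathrm{nor}}-\alpha^k(\widehat p_h^{\mathrm{tan}}-p_h^{\mathrm{tan}})$. The traces $\widehat u_h^{\mathrm{tan}}\in\widehat V_h^{k,\mathrm{tan}}$ and $\widehat u_h^{\mathrm{nor}}\in L^2\Lambda^{k-1}(\partial\mathcal T_h)$, the latter also single-valued ($\widehat u_h^{\mathrm{nor}}|_{e^+}+\widehat u_h^{\mathrm{nor}}|_{e^-}=0$ on interior facets), satisfy $\dot{\widehat u}_h=\widehat p_h$, and at $t=t_0$ $$(u_h,\mathrm d\tau_h)_{\mathcal T_h}-\langle\widehat u_h^{\mathrm{nor}},\tau_h^{\mathrm{tan}}\rangle_{\partial\mathcal T_h}=-(\sigma_h,\tau_h)_{\mathcal T_h},\qquad(u_h,\delta\eta_h)_{\mathcal T_h}+\langle\widehat u_h^{\mathrm{tan}},\eta_h^{\mathrm{nor}}\rangle_{\partial\mathcal T_h}=-(\rho_h,\eta_h)_{\mathcal T_h}$$ for all $\tau_h\in W_h^{k-1}$, $\eta_h\in W_h^{k+1}$. No boundary conditions are imposed. First variations $(\tau_i,v_i,\eta_i,r_i)$,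 with their hatted traces, of a solution solve the same equations (in the roles of $\sigma_h,u_h,\rho_h,p_h$) with $f(t,u_h)$ replaced by $\frac{\partial f}{\partial u}(t,u_h)v_i$. The method is *multisymplectic* on $J$ if, for every solution along which $\partial f/\partial u$ is symmetric, all first variations $i=1,2$ of it, and every $K\in\mathcal T_h$, on $J$, $$\frac{\mathrm d}{\mathrm dt}\bigl[(v_1,r_2)_K-(v_2,r_1)_K\bigr]+\langle\widehat\tau_1^{\mathrm{tan}},\widehat v_2^{\mathrm{nor}}\rangle_{\partial K}+\langle\widehat v_1^{\mathrm{tan}},\widehat\eta_2^{\mathrm{nor}}\rangle_{\partial K}-\langle\widehat\tau_2^{\mathrm{tan}},\widehat v_1^{\mathrm{nor}}\rangle_{\partial K}-\langle\widehat v_2^{\mathrm{tan}},\widehat\eta_1^{\mathrm{nor}}\rangle_{\partial K}=0.$$ **Theorem.** If $\alpha^{k-1}$ is negative-definite on $L^2\Lambda^{k-1}(\partial\mathcal T_h)$ and $\alpha^k$ is positive-definite on $L^2\Lambda^k(\partial\mathcal T_h)$, then the method is not multisymplectic: on every nondegenerate interval $J\subseteq I$, with any initial time $t_0\in J$, on which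 the method has a solution, it is not multisymplectic; and for every $t_0\in I$ there is an interval $J\subseteq I$, a neighbourhood of $t_0$ in $I$, on which it does have a solution with initial time $t_0$. -/

import Mathlib

open MeasureTheory Set Topology
open scoped RealInnerProductSpace

noncomputable section

namespace HodgeLDG

/-! ### Exterior algebra and exterior calculus on Euclidean space -/

/-- The Euclidean space `ℝⁿ`. -/
abbrev E (n : ℕ) : Type := EuclideanSpace ℝ (Fin n)

/-- The exterior algebra `Alt ℝⁿ = ⨁ₖ Altᵏ ℝⁿ`.  A form `a` is given by its components `a I` in the
basis `dx^I = dx^{i₁} ∧ ⋯ ∧ dx^{iₖ}`, where `I = {i₁ < ⋯ < iₖ}`.  This basis is orthonormal for the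
inner product induced by the Euclidean one, so the inner product of `EuclideanSpace` is the
standard inner product on forms. -/
abbrev Alt (n : ℕ) : Type := EuclideanSpace ℝ (Finset (Fin n))

/-- `a` is homogeneous of degree `j`.  Degrees are integers, so that `k - 1` makes sense for
`k = 0`; there are no nonzero forms of degree `-1`. -/
def HasDegree {n : ℕ} (j : ℤ) (a : Alt n) : Prop :=
  ∀ I : Finset (Fin n), (I.card : ℤ) ≠ j → a I = 0

/-- The sign in `dx^i ∧ dx^(I \ {i}) = sgn i I • dx^(I ∪ {i})`. -/
def sgn {n : ℕ} (i : Fin n) (I : Finset (Fin n)) : ℝ :=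
  (-1) ^ (I.filter (· < i)).card

/-- The wedge product `ν♭ ∧ a`. -/
def wedge {n : ℕ} (ν : E n) (a : Alt n) : Alt n :=
  WithLp.toLp 2 fun J => ∑ i ∈ J, sgn i J * ν i * a (J.erase i)

/-- The contraction (interior product) `ι_ν a`. -/
def contract {n : ℕ} (ν : E n) (a : Alt n) : Alt n :=
  WithLp.toLp 2 fun I => ∑ i ∈ Iᶜ, sgn i I * ν i * a (insert i I)

/-- The partial derivative `∂ᵢ ω` of a differential form. -/
def pderivForm {n : ℕ} (i : Fin n) (ω : E n → Alt n) (x : E n) : Alt n :=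
  fderiv ℝ ω x (EuclideanSpace.single i 1)

/-- The exterior differential `d ω = ∑ᵢ dxⁱ ∧ ∂ᵢ ω`. -/
def extD {n : ℕ} (ω : E n → Alt n) (x : E n) : Alt n :=
  ∑ i, wedge (EuclideanSpace.single i 1) (pderivForm i ω x)

/-- The codifferential `δ ω = - ∑ᵢ ι_{eᵢ} ∂ᵢ ω`, the formal `L²` adjoint of `d`. -/
def codiff {n : ℕ} (ω : E n → Alt n) (x : E n) : Alt n :=
  -∑ i, contract (EuclideanSpace.single i 1) (pderivForm i ω x)

/-! A form on a hyperplane with unit normal `ν`, i.e. an element of `Alt (ν^⊥)`, is identified with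
the form on `ℝⁿ` obtained by composing with the orthogonal projection onto `ν^⊥`.  This is an
isometry of `Alt (ν^⊥)` onto `{a ∈ Alt ℝⁿ : ι_ν a = 0}`. -/

/-- The tangential trace (pullback to the hyperplane with unit normal `ν`): since
`a = ι_ν (ν♭ ∧ a) + ν♭ ∧ ι_ν a`, it is the component `ι_ν (ν♭ ∧ a)`. -/
def tanTr {n : ℕ} (ν : E n) (a : Alt n) : Alt n := contract ν (wedge ν a)

/-- The normal trace, for the outward unit normal `ν`.  As `tr (τ ∧ ⋆ a) = (τ, ι_ν a) vol_∂`, the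
form `⋆̂⁻¹ tr ⋆ a` is `ι_ν a`.  With it,
`⟨τ^tan, v^nor⟩_∂K = (d τ, v)_K - (τ, δ v)_K`. -/
def norTr {n : ℕ} (ν : E n) (a : Alt n) : Alt n := contract ν a

/-! ### Polynomial differential forms -/

/-- Exponents of the monomials in `n` variables of total degree at most `r`. -/
abbrev MonoIdx (n r : ℕ) : Type := {m : Fin n → Fin (r + 1) // ∑ i, (m i : ℕ) ≤ r}

/-- The finite-dimensional space `P_r Λ^j` of differential forms of degree `j` whose coefficients
are polynomials of degree at most `r`, given by the coefficients of `x^m dx^I`. -/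
abbrev PolyForm (n r : ℕ) (j : ℤ) : Type :=
  MonoIdx n r × {I : Finset (Fin n) // (I.card : ℤ) = j} → ℝ

/-- The differential form with the given coefficients. -/
def PolyForm.toForm {n r : ℕ} {j : ℤ} (c : PolyForm n r j) (x : E n) : Alt n :=
  WithLp.toLp 2 fun I =>
    if h : (I.card : ℤ) = j then
      ∑ m : MonoIdx n r, c (m, ⟨I, h⟩) * ∏ i, x i ^ (m.1 i : ℕ)
    else 0

/-! ### Meshes -/

/-- A partition of a bounded polyhedral domain of `ℝⁿ` (the interior of the union of the cells)
into finitely many non-overlapping polyhedral cells, e.g. a simplicial triangulation.  Each cell is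
the closure of its interior and its boundary is divided into finitely many planar facets, which
match from one cell to its neighbours. -/
structure PolyhedralMesh (n : ℕ) where
  /-- The (closed) cells `K`. -/
  cells : Finset (Set (E n))
  /-- The facets `e ⊂ ∂K` of a cell. -/
  facets : Set (E n) → Finset (Set (E n))
  /-- The unit normal to the facet `e` of `K`, pointing out of `K`. -/
  normal : Set (E n) → Set (E n) → E n
  cells_nonempty : cells.Nonempty
  isCompact_cell : ∀ K ∈ cells, IsCompact K
  nonempty_cell : ∀ K ∈ cells, K.Nonempty
  closure_interior_cell : ∀ K ∈ cells, closure (interior K) = K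
  disjoint_cells : ∀ K ∈ cells, ∀ L ∈ cells, K ≠ L → Disjoint (interior K) (interior L)
  frontier_cell : ∀ K ∈ cells, frontier K = ⋃ e ∈ facets K, e
  isCompact_facet : ∀ K ∈ cells, ∀ e ∈ facets K, IsCompact e
  nonempty_facet : ∀ K ∈ cells, ∀ e ∈ facets K, e.Nonempty
  closure_intrinsicInterior_facet :
    ∀ K ∈ cells, ∀ e ∈ facets K, closure (intrinsicInterior ℝ e) = e
  norm_normal : ∀ K ∈ cells, ∀ e ∈ facets K, ‖normal K e‖ = 1
  /-- The facet `e` spans a hyperplane orthogonal to `normal K e`. -/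
  vectorSpan_facet :
    ∀ K ∈ cells, ∀ e ∈ facets K, vectorSpan ℝ e = (Submodule.span ℝ {normal K e})ᗮ
  normal_outward : ∀ K ∈ cells, ∀ e ∈ facets K, ∀ x ∈ intrinsicInterior ℝ e,
    ∀ᶠ s : ℝ in 𝓝[>] 0, x + s • normal K e ∉ K ∧ x - s • normal K e ∈ interior K
  /-- Two facets coincide or do not overlap. -/
  facets_match : ∀ K ∈ cells, ∀ L ∈ cells, ∀ e ∈ facets K, ∀ e' ∈ facets L,
    e = e' ∨ Disjoint (intrinsicInterior ℝ e) e'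

variable {n : ℕ}

/-- The `L²` inner product `(a, b)_K`. -/
def cellInner (K : Set (E n)) (a b : E n → Alt n) : ℝ := ∫ x in K, ⟪a x, b x⟫

/-- The surface measure on a facet. -/
def surface (e : Set (E n)) : Measure (E n) :=
  (Measure.euclideanHausdorffMeasure (n - 1)).restrict e

/-- A family of forms on the boundaries of the cells: `w K e x` is the value at `x ∈ e` of the form
on the facet `e` of `K`.  It is double-valued on facets that are shared by two cells. -/
abbrev Trace (n : ℕ) : Type := Set (E n) → Set (E n) → E n → Alt n

/-- An element of the broken space `W_h^j = ∏_K P_r Λ^j(K)`. -/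
abbrev Broken (n r : ℕ) (j : ℤ) : Type := Set (E n) → PolyForm n r j

namespace PolyhedralMesh

variable (M : PolyhedralMesh n)

/-- The `L²` inner product `⟨a, b⟩_∂K`. -/
def bdryInner (K : Set (E n)) (a b : Trace n) : ℝ :=
  ∑ e ∈ M.facets K, ∫ x, ⟪a K e x, b K e x⟫ ∂(surface e)

/-- The `L²` inner product `⟨a, b⟩_∂T`, where `T` is the mesh. -/
def skelInner (a b : Trace n) : ℝ := ∑ K ∈ M.cells, M.bdryInner K a b

/-- The tangential traces `w^tan` of a broken form. -/
def tan {r : ℕ} {j : ℤ} (w : Broken n r j) : Trace n :=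
  fun K e x => tanTr (M.normal K e) ((w K).toForm x)

/-- The normal traces `w^nor` of a broken form. -/
def nor {r : ℕ} {j : ℤ} (w : Broken n r j) : Trace n :=
  fun K e x => norTr (M.normal K e) ((w K).toForm x)

/-- `w` is a family of `L²` forms of degree `j` on the boundaries of the cells, i.e.
`w ∈ L²Λ^j(∂T)`. -/
def IsL2Trace (j : ℤ) (w : Trace n) : Prop :=
  ∀ K ∈ M.cells, ∀ e ∈ M.facets K, MemLp (w K e) 2 (surface e) ∧
    ∀ x ∈ e, HasDegree j (w K e x) ∧ contract (M.normal K e) (w K e x) = 0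

/-- `w ∈ Ŵ^{j,tan} = ∏_K ∏_{e ⊂ ∂K} P_r Λ^j(e)`. -/
def IsPolyTrace (r : ℕ) (j : ℤ) (w : Trace n) : Prop :=
  ∀ K ∈ M.cells, ∀ e ∈ M.facets K, ∃ c : PolyForm n r j,
    ∀ x ∈ e, w K e x = c.toForm x ∧ contract (M.normal K e) (w K e x) = 0

/-- `w ∈ V̂^{j,tan}`: piecewise polynomial, and single-valued on interior facets. -/
def IsVhat (r : ℕ) (j : ℤ) (w : Trace n) : Prop :=
  M.IsPolyTrace r j w ∧
    ∀ K ∈ M.cells, ∀ L ∈ M.cells, ∀ e ∈ M.facets K, e ∈ M.facets L → ∀ x ∈ e, w K e x = w L e x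

/-- `e ⊂ ∂K` is a boundary facet: it belongs to no other cell. -/
def IsBoundaryFacet (K e : Set (E n)) : Prop := ∀ L ∈ M.cells, e ∈ M.facets L → L = K

/-- The subspace of `V̂^{j,tan}` of traces that vanish on the boundary of the domain. -/
def IsVhat0 (r : ℕ) (j : ℤ) (w : Trace n) : Prop :=
  M.IsVhat r j w ∧
    ∀ K ∈ M.cells, ∀ e ∈ M.facets K, M.IsBoundaryFacet K e → ∀ x ∈ e, w K e x = 0

/-- A normal trace is single-valued when its values from the two sides of each interior facet are
opposite (the two outward normals are). -/
def IsSingleValuedNor (w : Trace n) : Prop :=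
  ∀ K ∈ M.cells, ∀ L ∈ M.cells, K ≠ L → ∀ e ∈ M.facets K, e ∈ M.facets L →
    ∀ x ∈ e, w K e x + w L e x = 0

end PolyhedralMesh

/-! ### Penalties -/

/-- A piecewise-constant penalty operator: `α K e` is the scalar by which it multiplies on the
facet `e` of `K`. -/
abbrev Penalty (n : ℕ) : Type := Set (E n) → Set (E n) → ℝ

/-- The action of a penalty operator on traces. -/
def Penalty.act (α : Penalty n) (w : Trace n) : Trace n := fun K e x => α K e • w K e x

/-- `α` is positive-definite on `L²Λ^j(∂T)`. -/
def Penalty.IsPosDef (M : PolyhedralMesh n) (j : ℤ) (α : Penalty n) : Prop :=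
  ∀ w : Trace n, M.IsL2Trace j w → 0 < M.skelInner w w → 0 < M.skelInner (α.act w) w

/-- `α` is negative-definite on `L²Λ^j(∂T)`. -/
def Penalty.IsNegDef (M : PolyhedralMesh n) (j : ℤ) (α : Penalty n) : Prop :=
  ∀ w : Trace n, M.IsL2Trace j w → 0 < M.skelInner w w → M.skelInner (α.act w) w < 0

/-! ### The method -/

/-- A source term `f = ∏_K f_K`, `f_K : ℝ × P_r Λ^k(K) → L²Λ(K)`. -/
abbrev Source (n r k : ℕ) : Type :=
  (K : Set (E n)) → ℝ → PolyForm n r (k : ℤ) → Lp (Alt n) 2 ((volume : Measure (E n)).restrict K)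

/-- The derivative `∂f_K/∂u (t, u)` is symmetric. -/
def Source.SymmAt {r k : ℕ} (f : Source n r k) (K : Set (E n)) (t : ℝ)
    (u : PolyForm n r (k : ℤ)) : Prop :=
  ∀ v w : PolyForm n r (k : ℤ),
    cellInner K (fderiv ℝ (f K t) u v) w.toForm = cellInner K (fderiv ℝ (f K t) u w) v.toForm

/-- The standing assumptions on the source on the time interval `I`: it takes values in
`L²Λ^k(K)`, it is continuous in time and `C¹` in `u`, and `∂f/∂u` is symmetric. -/
structure Source.IsAdmissible {r k : ℕ} (M : PolyhedralMesh n) (I : Set ℝ)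
    (f : Source n r k) : Prop where
  degree : ∀ K ∈ M.cells, ∀ t ∈ I, ∀ u,
    ∀ᵐ x ∂((volume : Measure (E n)).restrict K), HasDegree (k : ℤ) (f K t u x)
  continuousOn : ∀ K ∈ M.cells,
    ContinuousOn (fun q : ℝ × PolyForm n r (k : ℤ) => f K q.1 q.2) (I ×ˢ univ)
  differentiable : ∀ K ∈ M.cells, ∀ t ∈ I, Differentiable ℝ (f K t)
  continuousOn_fderiv : ∀ K ∈ M.cells,
    ContinuousOn (fun q : ℝ × PolyForm n r (k : ℤ) => fderiv ℝ (f K q.1) q.2) (I ×ˢ univ)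
  symm : ∀ K ∈ M.cells, ∀ t ∈ I, ∀ u, f.SymmAt K t u

/-- The time-dependent unknowns of the method: the broken forms `σ, u, ρ, p` and the numerical
traces `σ̂^tan, p̂^tan, û^tan, û^nor`.  The remaining traces `p̂^nor, ρ̂^nor` are determined by the
fluxes, see `Fields.phatNor` and `Fields.rhohatNor`. -/
structure Fields (n r k : ℕ) where
  σ : ℝ → Broken n r ((k : ℤ) - 1)
  u : ℝ → Broken n r (k : ℤ)
  ρ : ℝ → Broken n r ((k : ℤ) + 1)
  p : ℝ → Broken n r (k : ℤ)
  sigmahatTan : ℝ → Trace n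
  phatTan : ℝ → Trace n
  uhatTan : ℝ → Trace n
  uhatNor : ℝ → Trace n

section Method

variable {r k : ℕ} (M : PolyhedralMesh n) (α₀ α₁ : Penalty n)

/-- `p̂^nor`, from the flux condition `(p̂^nor - p^nor) + α^{k-1} (σ̂^tan - σ^tan) = 0`. -/
def Fields.phatNor (z : Fields n r k) (t : ℝ) : Trace n :=
  M.nor (z.p t) - α₀.act (z.sigmahatTan t - M.tan (z.σ t))

/-- `ρ̂^nor`, from the flux condition `(ρ̂^nor - ρ^nor) + α^k (p̂^tan - p^tan) = 0`. -/
def Fields.rhohatNor (z : Fields n r k) (t : ℝ) : Trace n :=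
  M.nor (z.ρ t) - α₁.act (z.phatTan t - M.tan (z.p t))

/-- The time derivative on `J` of a broken form. -/
def timeDeriv {j : ℤ} (J : Set ℝ) (w : ℝ → Broken n r j) (t : ℝ) : Broken n r j :=
  fun K => derivWithin (fun s => w s K) J t

/-- The equations of the LDG-H method with fluxes in `p̂`, on the time interval `J` with initial time
`t₀`, with right-hand side `g t K ∈ L²Λ(K)` in the equation for `ṗ`. -/
structure SolvesMethod
    (g : ℝ → (K : Set (E n)) → Lp (Alt n) 2 ((volume : Measure (E n)).restrict K))
    (J : Set ℝ) (t₀ : ℝ) (z : Fields n r k) : Prop where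
  diff_σ : ∀ K ∈ M.cells, DifferentiableOn ℝ (fun t => z.σ t K) J
  diff_u : ∀ K ∈ M.cells, DifferentiableOn ℝ (fun t => z.u t K) J
  diff_ρ : ∀ K ∈ M.cells, DifferentiableOn ℝ (fun t => z.ρ t K) J
  diff_p : ∀ K ∈ M.cells, DifferentiableOn ℝ (fun t => z.p t K) J
  mem_sigmahatTan : ∀ t ∈ J, M.IsVhat r ((k : ℤ) - 1) (z.sigmahatTan t)
  mem_phatTan : ∀ t ∈ J, M.IsVhat r (k : ℤ) (z.phatTan t)
  mem_uhatTan : ∀ t ∈ J, M.IsVhat r (k : ℤ) (z.uhatTan t)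
  mem_uhatNor : ∀ t ∈ J, M.IsL2Trace ((k : ℤ) - 1) (z.uhatNor t)
  single_uhatNor : ∀ t ∈ J, M.IsSingleValuedNor (z.uhatNor t)
  /-- `(σ̇, τ) + (δ p, τ) + ⟨α^{k-1} (σ̂^tan - σ^tan), τ^tan⟩ = 0` -/
  eq_σ : ∀ t ∈ J, ∀ τ : Broken n r ((k : ℤ) - 1),
    ∑ K ∈ M.cells, cellInner K (timeDeriv J z.σ t K).toForm (τ K).toForm
      + ∑ K ∈ M.cells, cellInner K (codiff (z.p t K).toForm) (τ K).toForm
      + M.skelInner (α₀.act (z.sigmahatTan t - M.tan (z.σ t))) (M.tan τ) = 0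
  /-- `(u̇, r) = (p, r)` -/
  eq_u : ∀ t ∈ J, ∀ s : Broken n r (k : ℤ),
    ∑ K ∈ M.cells, cellInner K (timeDeriv J z.u t K).toForm (s K).toForm
      = ∑ K ∈ M.cells, cellInner K (z.p t K).toForm (s K).toForm
  /-- `(ρ̇, η) + (p, δ η) + ⟨p̂^tan, η^nor⟩ = 0` -/
  eq_ρ : ∀ t ∈ J, ∀ η : Broken n r ((k : ℤ) + 1),
    ∑ K ∈ M.cells, cellInner K (timeDeriv J z.ρ t K).toForm (η K).toForm
      + ∑ K ∈ M.cells, cellInner K (z.p t K).toForm (codiff (η K).toForm)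
      + M.skelInner (z.phatTan t) (M.nor η) = 0
  /-- `-(ṗ, v) + (σ, δ v) + (δ ρ, v) + ⟨σ̂^tan, v^nor⟩ + ⟨α^k (p̂^tan - p^tan), v^tan⟩ = (g, v)` -/
  eq_p : ∀ t ∈ J, ∀ v : Broken n r (k : ℤ),
    -∑ K ∈ M.cells, cellInner K (timeDeriv J z.p t K).toForm (v K).toForm
      + ∑ K ∈ M.cells, cellInner K (z.σ t K).toForm (codiff (v K).toForm)
      + ∑ K ∈ M.cells, cellInner K (codiff (z.ρ t K).toForm) (v K).toForm
      + M.skelInner (z.sigmahatTan t) (M.nor v)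
      + M.skelInner (α₁.act (z.phatTan t - M.tan (z.p t))) (M.tan v)
      = ∑ K ∈ M.cells, cellInner K (g t K) (v K).toForm
  /-- conservativity: `⟨p^nor - α^{k-1} (σ̂^tan - σ^tan), τ̂^tan⟩ = 0` -/
  cons_p : ∀ t ∈ J, ∀ τhat : Trace n, M.IsVhat0 r ((k : ℤ) - 1) τhat →
    M.skelInner (z.phatNor M α₀ t) τhat = 0
  /-- conservativity: `⟨ρ^nor - α^k (p̂^tan - p^tan), v̂^tan⟩ = 0` -/
  cons_ρ : ∀ t ∈ J, ∀ vhat : Trace n, M.IsVhat0 r (k : ℤ) vhat →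
    M.skelInner (z.rhohatNor M α₁ t) vhat = 0
  /-- `(d/dt) û^tan = p̂^tan` -/
  deriv_uhatTan : ∀ t ∈ J, ∀ K ∈ M.cells, ∀ e ∈ M.facets K, ∀ x ∈ e,
    HasDerivWithinAt (fun s => z.uhatTan s K e x) (z.phatTan t K e x) J t
  /-- `(d/dt) û^nor = p̂^nor` -/
  deriv_uhatNor : ∀ t ∈ J, ∀ K ∈ M.cells, ∀ e ∈ M.facets K, ∀ x ∈ e,
    HasDerivWithinAt (fun s => z.uhatNor s K e x) (z.phatNor M α₀ t K e x) J t
  /-- constraint at the initial time: `(u, d τ) - ⟨û^nor, τ^tan⟩ = -(σ, τ)` -/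
  init_σ : ∀ τ : Broken n r ((k : ℤ) - 1),
    ∑ K ∈ M.cells, cellInner K (z.u t₀ K).toForm (extD (τ K).toForm)
      - M.skelInner (z.uhatNor t₀) (M.tan τ)
      = -∑ K ∈ M.cells, cellInner K (z.σ t₀ K).toForm (τ K).toForm
  /-- constraint at the initial time: `(u, δ η) + ⟨û^tan, η^nor⟩ = -(ρ, η)` -/
  init_ρ : ∀ η : Broken n r ((k : ℤ) + 1),
    ∑ K ∈ M.cells, cellInner K (z.u t₀ K).toForm (codiff (η K).toForm)
      + M.skelInner (z.uhatTan t₀) (M.nor η)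
      = -∑ K ∈ M.cells, cellInner K (z.ρ t₀ K).toForm (η K).toForm

/-- `z` is a solution of the method for the source `f`. -/
def IsSolution (f : Source n r k) (J : Set ℝ) (t₀ : ℝ) (z : Fields n r k) : Prop :=
  SolvesMethod M α₀ α₁ (fun t K => f K t (z.u t K)) J t₀ z

/-- `w` is a first variation of `z`: a solution of the equations linearized at `z`. -/
def IsFirstVariation (f : Source n r k) (J : Set ℝ) (t₀ : ℝ) (z w : Fields n r k) : Prop :=
  SolvesMethod M α₀ α₁ (fun t K => fderiv ℝ (f K t) (z.u t K) (w.u t K)) J t₀ w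

/-- `(J w₁, w₂)_K = (v₁, r₂)_K - (v₂, r₁)_K`, where `vᵢ, rᵢ` are the `u`- and `p`-components of
`wᵢ`. -/
def sympForm (K : Set (E n)) (w₁ w₂ : Fields n r k) (t : ℝ) : ℝ :=
  cellInner K (w₁.u t K).toForm (w₂.p t K).toForm
    - cellInner K (w₂.u t K).toForm (w₁.p t K).toForm

/-- The bracket `[ŵ₁, ŵ₂]_∂K` of the numerical traces. -/
def hatBracket (K : Set (E n)) (w₁ w₂ : Fields n r k) (t : ℝ) : ℝ :=
  (M.bdryInner K (w₁.sigmahatTan t) (w₂.uhatNor t)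
      + M.bdryInner K (w₁.uhatTan t) (w₂.rhohatNor M α₁ t))
    - (M.bdryInner K (w₂.sigmahatTan t) (w₁.uhatNor t)
      + M.bdryInner K (w₂.uhatTan t) (w₁.rhohatNor M α₁ t))

/-- The method is (weakly) multisymplectic on the time interval `J` with initial time `t₀`: whenever
`z` is a solution along which `∂f/∂u` is symmetric and `w₁, w₂` are first variations of `z`, the
local conservation law `(d/dt) (J w₁, w₂)_K + [ŵ₁, ŵ₂]_∂K = 0` holds for every cell `K`. -/
def IsMultisymplectic (f : Source n r k) (J : Set ℝ) (t₀ : ℝ) : Prop :=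
  ∀ z : Fields n r k, IsSolution M α₀ α₁ f J t₀ z →
    (∀ K ∈ M.cells, ∀ t ∈ J, f.SymmAt K t (z.u t K)) →
    ∀ w₁ w₂ : Fields n r k, IsFirstVariation M α₀ α₁ f J t₀ z w₁ →
      IsFirstVariation M α₀ α₁ f J t₀ z w₂ →
      ∀ K ∈ M.cells, ∀ t ∈ J,
        HasDerivWithinAt (fun s => sympForm K w₁ w₂ s) (-hatBracket M α₁ K w₁ w₂ t) J t

end Method

end HodgeLDG

end

/-! The conservation law already fails at the initial time, because the traces û are essentially
free there. If a first variation has u = 0 at t₀, the initial constraints only say that σ and -ρ are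
the Riesz representatives of the boundary functionals given by û^nor and û^tan. Hence û^tan, û^nor
and p can all be prescribed at t₀ (`exists_firstVariation`). For two such variations the derivative
of the symplectic form at t₀ is (p₁, p₂)_K - (p₂, p₁)_K = 0, so multisymplecticity would force the
bracket of the numerical traces on ∂K to vanish (`IsMultisymplectic.hatBracket_eq_zero`).

Two variations with nonzero bracket are then written down. The second has û = 0, hence σ = ρ = 0,
and p a constant form b on one cell K and zero elsewhere. The first has p = 0 and û supported on one
facet e of K. If k < n, û₁^tan is taken to be the tangential trace a of b, and only ⟨û₁^tan,
ρ̂₂^nor⟩ survives. It equals |e| α(1 - cα)‖a‖² with α = α^k on the side K of e, and it is positive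
(`not_isMultisymplectic_of_lt`). If k = n, tangential traces of k-forms vanish. Then û₁^nor is the
normal trace a of b, and the surviving term is -⟨σ̂₂^tan, û₁^nor⟩ = -|e| c‖a‖², nonzero because c =
1/∑α^{k-1} (`not_isMultisymplectic_of_pos`).

Existence rests on eliminating the numerical traces. On an interior facet, single-valuedness of
q^nor - α(ŵ - w^tan) is obtained from ŵ = c ∑(α w^tan + q^nor) with c = 1/∑α, the sums being over
the two sides. Definiteness gives every scalar α the same sign (`Penalty.IsPosDef.pos`,
`Penalty.IsNegDef.neg`), so ∑α ≠ 0. On boundary facets no equation fixes ŵ, and c is chosen there at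
will. In degrees -1 and n definiteness says nothing, but the traces involved are zero. What remains
is an ordinary differential equation for (σ, u, ρ, p) in finite dimension
(`exists_evolution_field`), nonlinear only through f. It is solved locally for the method itself
(`exists_solution`) and on all of J for the linearization. -/

namespace HodgeLDG

/-! ### Exterior algebra -/

section Algebra

variable {n : ℕ}

/-- `wedge ν` as a linear map. -/
def wedgeL (ν : E n) : Alt n →ₗ[ℝ] Alt n where
  toFun := wedge ν
  map_add' a b := by
    ext J
    simp [wedge, mul_add, Finset.sum_add_distrib]
  map_smul' c a := by
    ext J
    simp only [wedge, PiLp.smul_apply, smul_eq_mul, RingHom.id_apply, Finset.mul_sum]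
    exact Finset.sum_congr rfl fun i _ => by ring

/-- `contract ν` as a linear map. -/
def contractL (ν : E n) : Alt n →ₗ[ℝ] Alt n where
  toFun := contract ν
  map_add' a b := by
    ext J
    simp [contract, mul_add, Finset.sum_add_distrib]
  map_smul' c a := by
    ext J
    simp only [contract, PiLp.smul_apply, smul_eq_mul, RingHom.id_apply, Finset.mul_sum]
    exact Finset.sum_congr rfl fun i _ => by ring

/-- `tanTr ν` as a linear map. -/
def tanTrL (ν : E n) : Alt n →ₗ[ℝ] Alt n := contractL ν ∘ₗ wedgeL ν

@[simp] lemma contractL_apply (ν : E n) (a : Alt n) : contractL ν a = contract ν a := rfl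

lemma contract_neg_left (ν : E n) (a : Alt n) : contract (-ν) a = -contract ν a := by
  ext I
  simp [contract]

lemma HasDegree.wedge {j : ℤ} {a : Alt n} (ha : HasDegree j a) (ν : E n) :
    HasDegree (j + 1) (wedge ν a) := by
  intro J hJ
  refine Finset.sum_eq_zero fun i hi => ?_
  rw [ha, mul_zero]
  have := Finset.card_erase_add_one hi
  omega

lemma HasDegree.contract {j : ℤ} {a : Alt n} (ha : HasDegree j a) (ν : E n) :
    HasDegree (j - 1) (contract ν a) := by
  intro J hJ
  refine Finset.sum_eq_zero fun i hi => ?_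
  rw [ha, mul_zero]
  have := Finset.card_insert_of_notMem (Finset.mem_compl.1 hi)
  omega

lemma HasDegree.tanTr {j : ℤ} {a : Alt n} (ha : HasDegree j a) (ν : E n) :
    HasDegree j (tanTr ν a) := by
  have h := (ha.wedge ν).contract ν
  rwa [add_sub_cancel_right] at h

lemma HasDegree.eq_zero {j : ℤ} {a : Alt n} (ha : HasDegree j a) (hj : j < 0 ∨ n < j) :
    a = 0 := by
  ext I
  refine ha I ?_
  have := Finset.card_le_univ I
  simp only [Fintype.card_fin] at this
  omega

lemma HasDegree.zero (j : ℤ) : HasDegree j (0 : Alt n) := fun _ _ => rfl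

lemma HasDegree.add {j : ℤ} {a b : Alt n} (ha : HasDegree j a) (hb : HasDegree j b) :
    HasDegree j (a + b) := fun I hI => by simp [ha I hI, hb I hI]

lemma HasDegree.neg {j : ℤ} {a : Alt n} (ha : HasDegree j a) :
    HasDegree j (-a) := fun I hI => by simp [ha I hI]

/-- The terms indexed by pairs (I, i) with i ∉ I are matched with pairs (J, i), i ∈ J, through J = I
∪ {i}. The sign only counts indices below i, so it is the same for I and J. -/
lemma inner_contract (ν : E n) (a b : Alt n) : ⟪contract ν a, b⟫ = ⟪a, wedge ν b⟫ := by
  simp only [PiLp.inner_apply, contract, wedge, RCLike.inner_apply, conj_trivial,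
    Finset.mul_sum, Finset.sum_mul]
  rw [Finset.sum_sigma', Finset.sum_sigma']
  refine Finset.sum_bij' (fun x _ => ⟨insert x.2 x.1, x.2⟩) (fun x _ => ⟨x.1.erase x.2, x.2⟩)
    ?_ ?_ ?_ ?_ ?_
  · rintro ⟨I, i⟩ h
    simp
  · rintro ⟨I, i⟩ h
    simp
  · rintro ⟨I, i⟩ h
    simp only [Finset.mem_sigma, Finset.mem_univ, Finset.mem_compl, true_and] at h
    simp [h]
  · rintro ⟨I, i⟩ h
    simp only [Finset.mem_sigma, Finset.mem_univ, true_and] at h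
    simp [Finset.insert_erase h]
  · rintro ⟨I, i⟩ h
    simp only [Finset.mem_sigma, Finset.mem_univ, Finset.mem_compl, true_and] at h
    have : sgn i (insert i I) = sgn i I := by simp [sgn, Finset.filter_insert]
    simp only [this, Finset.erase_insert h]
    ring

/-- Removing the smaller index shifts the position of the larger one by one, while removing the
larger index leaves the smaller one in place. This is the anticommutation behind `wedge_wedge`. -/
lemma sgn_mul_sgn_erase {i l : Fin n} {J : Finset (Fin n)} (hi : i ∈ J) (hil : i < l) :
    sgn i J * sgn l (J.erase i) = -(sgn l J * sgn i (J.erase l)) := by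
  have h1 : sgn i (J.erase l) = sgn i J := by
    unfold sgn
    congr 2
    ext x
    simp only [Finset.mem_filter, Finset.mem_erase]
    constructor
    · tauto
    · rintro ⟨hx, hxi⟩
      exact ⟨⟨(hxi.trans hil).ne, hx⟩, hxi⟩
  have h2 : sgn l J = -sgn l (J.erase i) := by
    unfold sgn
    rw [Finset.filter_erase, ← Finset.card_erase_add_one (s := J.filter (· < l)) (a := i)
      (by simp [hi, hil]), pow_succ]
    ring
  rw [h1, h2]
  ring

lemma wedge_wedge (ν : E n) (a : Alt n) : wedge ν (wedge ν a) = 0 := by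
  ext J
  simp only [wedge, Finset.mul_sum, PiLp.zero_apply]
  rw [Finset.sum_sigma']
  refine Finset.sum_involution (fun x _ => ⟨x.2, x.1⟩) ?_ ?_ ?_ ?_
  · rintro ⟨i, l⟩ h
    simp only [Finset.mem_sigma, Finset.mem_erase] at h
    obtain ⟨hi, hli, hl⟩ := h
    have key : sgn i J * sgn l (J.erase i) = -(sgn l J * sgn i (J.erase l)) := by
      rcases lt_or_gt_of_ne hli with h | h
      · rw [sgn_mul_sgn_erase hl h, neg_neg]
      · exact sgn_mul_sgn_erase hi h
    rw [Finset.erase_right_comm (a := l)]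
    linear_combination (ν i * ν l * a ((J.erase i).erase l)) * key
  · rintro ⟨i, l⟩ h _ h'
    simp only [Finset.mem_sigma, Finset.mem_erase] at h
    simp only [Sigma.mk.injEq, heq_eq_eq] at h'
    exact h.2.1 h'.1
  · rintro ⟨i, l⟩ h
    simp only [Finset.mem_sigma, Finset.mem_erase] at h ⊢
    exact ⟨h.2.2, h.2.1.symm, h.1⟩
  · rintro ⟨i, l⟩ h
    rfl

lemma contract_contract (ν : E n) (a : Alt n) : contract ν (contract ν a) = 0 := by
  refine ext_inner_right ℝ fun b => ?_
  rw [inner_contract, inner_contract, wedge_wedge, inner_zero_right, inner_zero_left]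

lemma contract_tanTr (ν : E n) (a : Alt n) : contract ν (tanTr ν a) = 0 := contract_contract ν _

lemma contract_norTr (ν : E n) (a : Alt n) : contract ν (norTr ν a) = 0 := contract_contract ν _

lemma inner_tanTr_self (ν : E n) (a : Alt n) : ⟪tanTr ν a, a⟫ = ‖wedge ν a‖ ^ 2 := by
  rw [tanTr, inner_contract, real_inner_self_eq_norm_sq]

/-- Below top degree there are homogeneous forms with nonzero tangential trace. -/
lemma exists_tanTr_ne_zero {ν : E n} (hν : ν ≠ 0) {j : ℕ} (hj : j < n) :
    ∃ a : Alt n, HasDegree (j : ℤ) a ∧ tanTr ν a ≠ 0 := by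
  obtain ⟨i, hi⟩ : ∃ i, ν i ≠ 0 := by
    by_contra! h
    exact hν (by ext i; simpa using h i)
  obtain ⟨I, hIs, hI⟩ := Finset.exists_subset_card_eq (s := Finset.univ.erase i) (n := j)
    (by simp; omega)
  have hiI : i ∉ I := fun h => by simpa using hIs h
  refine ⟨EuclideanSpace.single I 1, ?_, fun h => ?_⟩
  · intro L hL
    have : L ≠ I := by rintro rfl; exact hL (by simp [hI])
    simp [this]
  -- A vanishing tangential trace would give ν ∧ dx^I = 0, but the component of this form at I ∪ {i}
  -- is ± ν i.
  · have h2 := inner_tanTr_self ν (EuclideanSpace.single I 1)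
    rw [h, inner_zero_left] at h2
    have h3 : wedge ν (EuclideanSpace.single I 1) = 0 := by
      simpa using h2.symm
    have h4 : wedge ν (EuclideanSpace.single I (1 : ℝ)) (insert i I) = sgn i (insert i I) * ν i := by
      simp only [wedge]
      rw [Finset.sum_eq_single i]
      · simp [hiI]
      · intro l hl hli
        have : (insert i I).erase l ≠ I := by
          intro h
          have : i ∈ (insert i I).erase l := by simp [Ne.symm hli]
          exact hiI (h ▸ this)
        simp [this]
      · simp
    rw [h3] at h4
    have : sgn i (insert i I) ≠ 0 := by simp [sgn]
    exact mul_ne_zero this hi h4.symm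

/-- In positive degree there are homogeneous forms with nonzero normal trace. -/
lemma exists_norTr_ne_zero {ν : E n} (hν : ν ≠ 0) {j : ℕ} (hj : j < n) :
    ∃ a : Alt n, HasDegree ((j : ℤ) + 1) a ∧ norTr ν a ≠ 0 := by
  obtain ⟨a, ha, h⟩ := exists_tanTr_ne_zero hν hj
  exact ⟨wedge ν a, ha.wedge ν, h⟩

end Algebra

/-! ### Polynomial forms -/

namespace PolyForm

variable {n r : ℕ} {j : ℤ}

/-- The coefficient of a polynomial form at the monomial `x^m`. -/
def coef (c : PolyForm n r j) (m : MonoIdx n r) : Alt n :=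
  WithLp.toLp 2 fun I => if h : (I.card : ℤ) = j then c (m, ⟨I, h⟩) else 0

lemma hasDegree_coef (c : PolyForm n r j) (m : MonoIdx n r) : HasDegree j (c.coef m) := by
  intro I hI
  simp [coef, hI]

/-- The monomial `x^m`. -/
def monom (m : MonoIdx n r) (x : E n) : ℝ := ∏ i, x i ^ (m.1 i : ℕ)

lemma toForm_eq_sum (c : PolyForm n r j) (x : E n) :
    c.toForm x = ∑ m, monom m x • c.coef m := by
  ext I
  simp only [toForm, coef, monom, WithLp.ofLp_sum, WithLp.ofLp_smul, Finset.sum_apply,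
    Pi.smul_apply, smul_eq_mul]
  split_ifs with h
  · exact Finset.sum_congr rfl fun m _ => mul_comm _ _
  · simp

lemma coef_add (c d : PolyForm n r j) (m : MonoIdx n r) :
    (c + d).coef m = c.coef m + d.coef m := by
  ext I
  simp only [coef, Pi.add_apply, PiLp.add_apply]
  split_ifs <;> simp

lemma coef_smul (a : ℝ) (c : PolyForm n r j) (m : MonoIdx n r) :
    (a • c).coef m = a • c.coef m := by
  ext I
  simp only [coef, Pi.smul_apply, PiLp.smul_apply]
  split_ifs <;> simp

/-- The form with given coefficients, as a linear map into functions. -/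
def toFormL : PolyForm n r j →ₗ[ℝ] (E n → Alt n) where
  toFun := toForm
  map_add' c d := by
    funext x
    simp [toForm_eq_sum, coef_add, Finset.sum_add_distrib]
  map_smul' a c := by
    funext x
    simp [toForm_eq_sum, coef_smul, Finset.smul_sum, smul_comm a]

lemma toForm_add (c d : PolyForm n r j) : (c + d).toForm = c.toForm + d.toForm := toFormL.map_add c d
lemma toForm_smul (a : ℝ) (c : PolyForm n r j) : (a • c).toForm = a • c.toForm :=
  toFormL.map_smul a c
lemma toForm_zero : (0 : PolyForm n r j).toForm = 0 := toFormL.map_zero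

lemma hasDegree_toForm (c : PolyForm n r j) (x : E n) : HasDegree j (c.toForm x) := by
  intro I hI
  simp [toForm, hI]

lemma contDiff_toForm (c : PolyForm n r j) : ContDiff ℝ 1 c.toForm := by
  have : c.toForm = fun x => ∑ m, monom m x • c.coef m := funext (toForm_eq_sum c)
  rw [this]
  unfold monom
  fun_prop

lemma continuous_toForm (c : PolyForm n r j) : Continuous c.toForm := c.contDiff_toForm.continuous

/-- The polynomial form `x^0 ⊗ a`. -/
def const (n r : ℕ) (j : ℤ) (a : Alt n) : PolyForm n r j :=
  fun q => if q.1 = ⟨0, by simp⟩ then a q.2.1 else 0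

lemma toForm_const {a : Alt n} (ha : HasDegree j a) (x : E n) :
    (const n r j a).toForm x = a := by
  have h : ∀ m : MonoIdx n r, (const n r j a).coef m = if m = ⟨0, by simp⟩ then a else 0 := by
    intro m
    ext I
    by_cases hI : (I.card : ℤ) = j
    · simp only [coef, const, hI, dite_true]
      split_ifs <;> simp
    · rw [hasDegree_coef _ _ I hI]
      split_ifs
      · exact (ha I hI).symm
      · rfl
  simp [toForm_eq_sum, h, monom]

/-- Apply a linear map to the values of a polynomial form. -/
def mapForm {j' : ℤ} (L : Alt n →ₗ[ℝ] Alt n) (c : PolyForm n r j) : PolyForm n r j' :=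
  fun q => L (c.coef q.1) q.2.1

/-- Constant-coefficient operations on values do not raise the polynomial degree. Hence tangential
and normal traces on a planar facet are again traces of forms in P_r, which puts the numerical
traces in the discrete trace space. -/
lemma toForm_mapForm {j' : ℤ} {L : Alt n →ₗ[ℝ] Alt n}
    (hL : ∀ a, HasDegree j a → HasDegree j' (L a)) (c : PolyForm n r j) (x : E n) :
    (mapForm (j' := j') L c).toForm x = L (c.toForm x) := by
  have : ∀ m, (mapForm (j' := j') L c).coef m = L (c.coef m) := by
    intro m
    ext I
    simp only [coef, mapForm]
    split_ifs with h
    · rfl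
    · exact (hL _ (c.hasDegree_coef m) I h).symm
  simp [toForm_eq_sum, this]

/-- The codifferential on polynomial forms, as a linear map into functions. -/
noncomputable def codiffL : PolyForm n r j →ₗ[ℝ] (E n → Alt n) where
  toFun c := codiff c.toForm
  map_add' c d := by
    funext x
    have h : ∀ c : PolyForm n r j, DifferentiableAt ℝ c.toForm x := fun c =>
      c.contDiff_toForm.differentiable one_ne_zero x
    simp only [codiff, pderivForm, toForm_add, fderiv_add (h c) (h d), Pi.add_apply, ← contractL_apply,
      add_apply, map_add, Finset.sum_add_distrib, neg_add]
  map_smul' a c := by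
    funext x
    have h : ∀ c : PolyForm n r j, DifferentiableAt ℝ c.toForm x := fun c =>
      c.contDiff_toForm.differentiable one_ne_zero x
    simp only [codiff, pderivForm, toForm_smul, fderiv_const_smul (h c), Pi.smul_apply, ← contractL_apply,
      smul_apply, map_smul, Finset.smul_sum, smul_neg, RingHom.id_apply]

lemma continuous_codiff (c : PolyForm n r j) : Continuous (codiff c.toForm) := by
  have h : Continuous (fderiv ℝ c.toForm) := c.contDiff_toForm.continuous_fderiv one_ne_zero
  unfold codiff pderivForm
  refine (continuous_finsetSum _ fun i _ => ?_).neg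
  exact (LinearMap.continuous_of_finiteDimensional
    (contractL (EuclideanSpace.single i (1 : ℝ)))).comp (h.clm_apply continuous_const)

/-- A polynomial form that vanishes on a nonempty open set is zero. -/
lemma eq_zero_of_forall_mem {U : Set (E n)} (hU : IsOpen U) (hne : U.Nonempty)
    {c : PolyForm n r j} (h : ∀ x ∈ U, c.toForm x = 0) : c = 0 := by
  obtain ⟨x₀, hx₀⟩ := hne
  let V : Set (Fin n → ℝ) := (WithLp.toLp 2) ⁻¹' U
  have hV : IsOpen V := hU.preimage (PiLp.continuous_toLp 2 _)
  obtain ⟨ε, hε, hb⟩ := Metric.isOpen_iff.1 hV (x₀ : Fin n → ℝ) (by simpa [V] using hx₀)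
  funext ⟨m, I, hI⟩
  let e : MonoIdx n r → (Fin n →₀ ℕ) := fun m => Finsupp.equivFunOnFinite.symm fun i => (m.1 i : ℕ)
  have he : Function.Injective e := by
    intro a b hab
    have := Finsupp.equivFunOnFinite.symm.injective hab
    ext i
    exact congrFun this i
  -- The component of index `I` is a polynomial vanishing on a cube inside `U`, a product of
  -- infinite sets, so all its coefficients vanish.
  let P : MvPolynomial (Fin n) ℝ := ∑ m, MvPolynomial.monomial (e m) (c (m, ⟨I, hI⟩))
  have hP : P = 0 := by
    refine MvPolynomial.funext_set (fun i => Ioo (x₀ i - ε) (x₀ i + ε))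
      (fun i => Ioo_infinite (by linarith)) fun y hy => ?_
    have hyV : WithLp.toLp 2 y ∈ U := by
      refine hb ?_
      rw [mem_ball_iff_norm, pi_norm_lt_iff hε]
      intro i
      have := hy i (mem_univ i)
      simp only [mem_Ioo] at this
      rw [Real.norm_eq_abs, abs_lt]
      constructor <;> simp <;> linarith
    have h1 := congrArg (fun a : Alt n => a I) (h _ hyV)
    simp only [toForm, hI, dite_true, PiLp.zero_apply] at h1
    rw [map_zero]
    simp only [P, map_sum, MvPolynomial.eval_monomial]
    rw [← h1]
    refine Finset.sum_congr rfl fun m _ => ?_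
    rw [Finsupp.prod_fintype _ _ (by simp)]
    rfl
  have h2 := congrArg (MvPolynomial.coeff (e m)) hP
  simp only [P, MvPolynomial.coeff_sum, MvPolynomial.coeff_monomial, he.eq_iff,
    MvPolynomial.coeff_zero] at h2
  simpa using h2

end PolyForm

end HodgeLDG

namespace HodgeLDG

/-! ### Facets and integration -/

section Integration

variable {n : ℕ}

/-- A facet has positive and finite surface measure. -/
lemma facet_measure {e : Set (E n)} {ν : E n} (hc : IsCompact e) (hν : ‖ν‖ = 1)
    (hspan : vectorSpan ℝ e = (Submodule.span ℝ {ν})ᗮ) (hne : (intrinsicInterior ℝ e).Nonempty) :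
    Measure.euclideanHausdorffMeasure (n - 1) e ≠ 0 ∧
      Measure.euclideanHausdorffMeasure (n - 1) e ≠ ⊤ := by
  have hν0 : ν ≠ 0 := by rintro rfl; simp at hν
  obtain ⟨x₀, hx₀⟩ := hne
  have hx₀e : x₀ ∈ e := intrinsicInterior_subset hx₀
  set D : Submodule ℝ (E n) := vectorSpan ℝ e with hD
  have hrank : Module.finrank ℝ D = n - 1 := by
    have h1 := Submodule.finrank_add_finrank_orthogonal (Submodule.span ℝ {ν})
    rw [finrank_span_singleton hν0, finrank_euclideanSpace_fin, ← hspan] at h1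
    omega
  -- The facet is an isometric copy of a compact subset of its direction space `D`, of dimension n -
  -- 1. The relative interior becomes a genuine interior there, and Hausdorff measure in the full
  -- dimension of `D` is finite on compact sets and positive on sets with nonempty interior.
  let φ : D → E n := fun v => v + x₀
  have hφ : Isometry φ := by
    refine Isometry.of_dist_eq fun a b => ?_
    simp [φ, Subtype.dist_eq]
  have himg : φ '' (φ ⁻¹' e) = e := by
    rw [image_preimage_eq_iff]
    intro x hx
    exact ⟨⟨x - x₀, vsub_mem_vectorSpan ℝ hx hx₀e⟩, by simp [φ]⟩
  have hcpt : IsCompact (φ ⁻¹' e) := hφ.isClosedEmbedding.isCompact_preimage hc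
  have hint : (interior (φ ⁻¹' e)).Nonempty := by
    obtain ⟨y, hy, hyx⟩ := mem_intrinsicInterior.1 hx₀
    let ψ : D → affineSpan ℝ e := fun v => ⟨v + x₀, by
      have : (v : E n) ∈ (affineSpan ℝ e).direction := by
        rw [direction_affineSpan]; exact v.2
      exact AffineSubspace.vadd_mem_of_mem_direction this (mem_affineSpan ℝ hx₀e)⟩
    have hψ : Continuous ψ := by
      refine Continuous.subtype_mk ?_ _
      fun_prop
    refine ⟨0, ?_⟩
    have hop : IsOpen (ψ ⁻¹' interior (((↑) : affineSpan ℝ e → E n) ⁻¹' e)) :=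
      isOpen_interior.preimage hψ
    refine (interior_maximal ?_ hop) ?_
    · intro v hv
      have := interior_subset (mem_preimage.1 hv)
      exact this
    · have : ψ 0 = y := by
        ext1
        simp [ψ, hyx]
      rw [mem_preimage, this]
      exact hy
  have hμ : Measure.euclideanHausdorffMeasure (n - 1) e =
      Measure.euclideanHausdorffMeasure (Module.finrank ℝ D) (φ ⁻¹' e) := by
    rw [hrank, ← hφ.euclideanHausdorffMeasure_image, himg]
  rw [hμ]
  refine ⟨?_, hcpt.measure_ne_top⟩
  exact (Measure.measure_pos_of_nonempty_interior _ hint).ne'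

lemma integrable_inner {μ : Measure (E n)} {s : Set (E n)} (hs : IsCompact s) (hμ : μ s ≠ ⊤)
    {f g : E n → Alt n} (hf : Continuous f) (hg : Continuous g) :
    Integrable (fun x => ⟪f x, g x⟫) (μ.restrict s) := by
  have hc : Continuous fun x => ⟪f x, g x⟫ := hf.inner hg
  obtain ⟨C, hC⟩ := hs.exists_bound_of_continuousOn hc.continuousOn
  exact Measure.integrableOn_of_bounded hμ hc.aestronglyMeasurable
    (ae_restrict_of_forall_mem hs.measurableSet hC)

lemma memLp_of_continuous {μ : Measure (E n)} {s : Set (E n)} (hs : IsCompact s) (hμ : μ s ≠ ⊤)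
    {f : E n → Alt n} (hf : Continuous f) : MemLp f 2 (μ.restrict s) := by
  obtain ⟨C, hC⟩ := hs.exists_bound_of_continuousOn hf.continuousOn
  have : IsFiniteMeasure (μ.restrict s) := ⟨by simpa using hμ.lt_top⟩
  exact MemLp.of_bound hf.aestronglyMeasurable C (ae_restrict_of_forall_mem hs.measurableSet hC)

variable {V W : Type*} [AddCommGroup V] [Module ℝ V] [AddCommGroup W] [Module ℝ W]

/-- The bilinear form `∫_s ⟪F v, G w⟫ dμ` for linear families `F, G` of continuous functions. -/
noncomputable def pairing (F : V →ₗ[ℝ] (E n → Alt n)) (G : W →ₗ[ℝ] (E n → Alt n))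
    (hF : ∀ v, Continuous (F v)) (hG : ∀ w, Continuous (G w))
    {μ : Measure (E n)} {s : Set (E n)} (hs : IsCompact s) (hμ : μ s ≠ ⊤) : V →ₗ[ℝ] W →ₗ[ℝ] ℝ :=
  LinearMap.mk₂ ℝ (fun v w => ∫ x, ⟪F v x, G w x⟫ ∂(μ.restrict s))
    (fun v v' w => by
      simp only [map_add, Pi.add_apply, inner_add_left]
      exact integral_add (integrable_inner hs hμ (hF v) (hG w))
        (integrable_inner hs hμ (hF v') (hG w)))
    (fun c v w => by
      simp only [map_smul, Pi.smul_apply, real_inner_smul_left]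
      exact integral_const_mul _ _)
    (fun v w w' => by
      simp only [map_add, Pi.add_apply, inner_add_right]
      exact integral_add (integrable_inner hs hμ (hF v) (hG w))
        (integrable_inner hs hμ (hF v) (hG w')))
    (fun c v w => by
      simp only [map_smul, Pi.smul_apply, real_inner_smul_right]
      exact integral_const_mul _ _)

lemma cellInner_comm (K : Set (E n)) (a b : E n → Alt n) : cellInner K a b = cellInner K b a := by
  simp only [cellInner, real_inner_comm]

@[simp] lemma cellInner_zero_left (K : Set (E n)) (b : E n → Alt n) : cellInner K 0 b = 0 := by
  simp [cellInner]

@[simp] lemma cellInner_zero_right (K : Set (E n)) (a : E n → Alt n) : cellInner K a 0 = 0 := by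
  simp [cellInner]

variable {r : ℕ} {j : ℤ}

/-- The `L²(K)` inner product on polynomial forms. -/
noncomputable def cellForm (r : ℕ) (j : ℤ) {K : Set (E n)} (hK : IsCompact K) :
    PolyForm n r j →ₗ[ℝ] PolyForm n r j →ₗ[ℝ] ℝ :=
  pairing (μ := volume) PolyForm.toFormL PolyForm.toFormL PolyForm.continuous_toForm
    PolyForm.continuous_toForm hK hK.measure_ne_top

lemma cellForm_apply {K : Set (E n)} (hK : IsCompact K) (v w : PolyForm n r j) :
    cellForm r j hK v w = cellInner K v.toForm w.toForm := rfl

/-- The integrand vanishes almost everywhere on K, hence everywhere on the interior by continuity,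
and a polynomial form vanishing on an open set is zero. -/
lemma eq_zero_of_cellInner_self {K : Set (E n)} (hK : IsCompact K) (hK' : (interior K).Nonempty)
    {c : PolyForm n r j} (h : cellInner K c.toForm c.toForm = 0) : c = 0 := by
  refine PolyForm.eq_zero_of_forall_mem isOpen_interior hK' ?_
  have hint := integrable_inner (μ := volume) hK hK.measure_ne_top c.continuous_toForm
    c.continuous_toForm
  have h1 := (integral_eq_zero_iff_of_nonneg (fun x => real_inner_self_nonneg) hint).1 h
  have h2 := ae_restrict_of_ae_restrict_of_subset interior_subset h1
  have hcont : Continuous fun x => ⟪c.toForm x, c.toForm x⟫ :=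
    c.continuous_toForm.inner c.continuous_toForm
  have h3 := Measure.eqOn_open_of_ae_eq h2 isOpen_interior hcont.continuousOn
    continuousOn_const
  intro x hx
  exact inner_self_eq_zero.1 (h3 hx)

/-- The L² product is definite on the finite-dimensional space of polynomial forms, so it identifies
this space with its dual. `R` is the inverse; it turns weak equations tested against polynomial
forms into explicit formulas for time derivatives. -/
lemma exists_riesz (r : ℕ) (j : ℤ) {K : Set (E n)} (hK : IsCompact K)
    (hK' : (interior K).Nonempty) :
    ∃ R : (PolyForm n r j →ₗ[ℝ] ℝ) →ₗ[ℝ] PolyForm n r j,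
      ∀ φ v, cellInner K (R φ).toForm v.toForm = φ v := by
  have hinj : Function.Injective (cellForm r j hK) := by
    rw [injective_iff_map_eq_zero]
    intro c hc
    refine eq_zero_of_cellInner_self hK hK' ?_
    rw [← cellForm_apply hK, hc]
    rfl
  let e := LinearEquiv.ofInjectiveOfFinrankEq (cellForm r j hK) hinj
    (Subspace.dual_finrank_eq (K := ℝ) (V := PolyForm n r j)).symm
  refine ⟨e.symm.toLinearMap, fun φ v => ?_⟩
  rw [← cellForm_apply hK]
  exact congrArg (fun ψ : PolyForm n r j →ₗ[ℝ] ℝ => ψ v) (e.apply_symm_apply φ)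

/-- The `L²(K)` projection onto polynomial forms. -/
lemma exists_projection (r : ℕ) (j : ℤ) {K : Set (E n)} (hK : IsCompact K)
    (hK' : (interior K).Nonempty) :
    ∃ P : Lp (Alt n) 2 ((volume : Measure (E n)).restrict K) →L[ℝ] PolyForm n r j,
      ∀ h, ∀ v : PolyForm n r j, cellInner K (P h).toForm v.toForm = cellInner K h v.toForm := by
  obtain ⟨R, hR⟩ := exists_riesz r j hK hK'
  have hmem : ∀ v : PolyForm n r j, MemLp v.toForm 2 ((volume : Measure (E n)).restrict K) :=
    fun v => memLp_of_continuous hK hK.measure_ne_top v.continuous_toForm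
  let T : PolyForm n r j →ₗ[ℝ] Lp (Alt n) 2 ((volume : Measure (E n)).restrict K) :=
    { toFun := fun v => (hmem v).toLp
      map_add' := fun v w => by
        rw [← MemLp.toLp_add]
        congr 1
        exact PolyForm.toForm_add v w
      map_smul' := fun a v => by
        rw [RingHom.id_apply, ← MemLp.toLp_const_smul]
        congr 1
        exact PolyForm.toForm_smul a v }
  let D : PolyForm n r j →ₗ[ℝ] PolyForm n r j →ₗ[ℝ] ℝ :=
    LinearMap.mk₂ ℝ (fun a v => ∑ i, v i * a i)
      (fun a b v => by simp [mul_add, Finset.sum_add_distrib])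
      (fun c a v => by
        simp only [Pi.smul_apply, smul_eq_mul, Finset.mul_sum]
        exact Finset.sum_congr rfl fun i _ => by ring)
      (fun a v w => by simp [add_mul, Finset.sum_add_distrib])
      (fun c a v => by
        simp only [Pi.smul_apply, smul_eq_mul, Finset.mul_sum]
        exact Finset.sum_congr rfl fun i _ => by ring)
  -- The projection is routed through the finitely many products of `h` with the coordinate forms.
  -- `Q` is continuous on the infinite-dimensional L² space, and the rest is linear in finite
  -- dimension.
  let Q : Lp (Alt n) 2 ((volume : Measure (E n)).restrict K) →L[ℝ] PolyForm n r j :=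
    ContinuousLinearMap.pi fun i => innerSL ℝ (T fun q => if i = q then 1 else 0)
  refine ⟨(R ∘ₗ D).toContinuousLinearMap ∘L Q, fun h v => ?_⟩
  have h1 : cellInner K h v.toForm = ⟪T v, h⟫ := by
    rw [L2.inner_def, cellInner_comm]
    refine integral_congr_ae ?_
    filter_upwards [(hmem v).coeFn_toLp] with x hx
    change _ = ⟪((hmem v).toLp : E n → Alt n) x, _⟫
    rw [hx]
  rw [h1, T.pi_apply_eq_sum_univ v, sum_inner]
  change cellInner K (R (D (Q h))).toForm v.toForm = _
  rw [hR]
  refine Finset.sum_congr rfl fun i _ => ?_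
  rw [real_inner_smul_left]
  rfl

end Integration

end HodgeLDG

/-! ### Ordinary differential equations -/

namespace HodgeLDG

section ODE

open scoped NNReal

variable {X : Type*} [NormedAddCommGroup X] [NormedSpace ℝ X]

/-- Radial retraction onto the closed ball of radius `R`. -/
noncomputable def clampNorm (R : ℝ) (x : X) : X := (R / max R ‖x‖) • x

lemma norm_clampNorm_le {R : ℝ} (hR : 0 < R) (x : X) : ‖clampNorm R x‖ ≤ R := by
  have hm : 0 < max R ‖x‖ := lt_max_of_lt_left hR
  rw [clampNorm, norm_smul, Real.norm_of_nonneg (by positivity), div_mul_eq_mul_div,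
    div_le_iff₀ hm]
  exact mul_le_mul_of_nonneg_left (le_max_right _ _) hR.le

lemma norm_clampNorm_le_norm {R : ℝ} (hR : 0 < R) (x : X) : ‖clampNorm R x‖ ≤ ‖x‖ := by
  have hm : 0 < max R ‖x‖ := lt_max_of_lt_left hR
  rw [clampNorm, norm_smul, Real.norm_of_nonneg (by positivity)]
  exact mul_le_of_le_one_left (norm_nonneg _) ((div_le_one hm).2 (le_max_left _ _))

lemma clampNorm_of_norm_le {R : ℝ} (hR : 0 < R) {x : X} (hx : ‖x‖ ≤ R) : clampNorm R x = x := by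
  rw [clampNorm, max_eq_left hx, div_self hR.ne', one_smul]

lemma lipschitzWith_clampNorm {R : ℝ} (hR : 0 < R) : LipschitzWith 2 (clampNorm R : X → X) := by
  refine LipschitzWith.of_dist_le_mul fun x y => ?_
  rw [dist_eq_norm, dist_eq_norm]
  have hx : 0 < max R ‖x‖ := lt_max_of_lt_left hR
  have hy : 0 < max R ‖y‖ := lt_max_of_lt_left hR
  have h1 : clampNorm R x - clampNorm R y =
      (R / max R ‖x‖) • (x - y) + (R / max R ‖x‖ - R / max R ‖y‖) • y := by
    simp only [clampNorm, smul_sub, sub_smul]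
    abel
  have h2 : R / max R ‖x‖ ≤ 1 := (div_le_one hx).2 (le_max_left _ _)
  have h2' : 0 ≤ R / max R ‖x‖ := by positivity
  have h3 : |R / max R ‖x‖ - R / max R ‖y‖| * ‖y‖ ≤ ‖x - y‖ := by
    have h4 : R / max R ‖x‖ - R / max R ‖y‖ =
        (R / max R ‖x‖) * ((max R ‖y‖ - max R ‖x‖) / max R ‖y‖) := by
      field_simp
    have h5 : |max R ‖y‖ - max R ‖x‖| ≤ ‖x - y‖ := by
      refine (abs_max_sub_max_le_max R ‖y‖ R ‖x‖).trans ?_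
      rw [sub_self, abs_zero, max_eq_right (abs_nonneg _), norm_sub_rev]
      exact abs_norm_sub_norm_le y x
    rw [h4, abs_mul, abs_of_nonneg h2', abs_div, abs_of_pos hy]
    calc R / max R ‖x‖ * (|max R ‖y‖ - max R ‖x‖| / max R ‖y‖) * ‖y‖
        ≤ 1 * (|max R ‖y‖ - max R ‖x‖| / max R ‖y‖) * max R ‖y‖ := by
          gcongr
          exact le_max_right _ _
      _ = |max R ‖y‖ - max R ‖x‖| := by field_simp
      _ ≤ _ := h5
  rw [h1]
  refine (norm_add_le _ _).trans ?_
  rw [norm_smul, norm_smul, Real.norm_of_nonneg h2', Real.norm_eq_abs]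
  have h6 : R / max R ‖x‖ * ‖x - y‖ ≤ ‖x - y‖ := mul_le_of_le_one_left (norm_nonneg _) h2
  simp only [NNReal.coe_ofNat]
  linarith

/-- Grönwall's bound on both sides of the initial time. -/
lemma norm_le_exp_of_norm_deriv_le {x x' : ℝ → X} {a b t₀ M : ℝ}
    (ht₀ : t₀ ∈ Icc a b) (hx : ∀ t ∈ Icc a b, HasDerivWithinAt x (x' t) (Icc a b) t)
    (hM : ∀ t ∈ Icc a b, ‖x' t‖ ≤ M * ‖x t‖) {t : ℝ} (ht : t ∈ Icc a b) :
    ‖x t‖ ≤ ‖x t₀‖ * Real.exp (M * |t - t₀|) := by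
  rcases le_total t₀ t with h | h
  · have := norm_le_gronwallBound_of_norm_deriv_right_le (f := x) (f' := x') (K := M) (ε := 0)
      (δ := ‖x t₀‖) (a := t₀) (b := b)
      (fun s hs => ((hx s ⟨ht₀.1.trans hs.1, hs.2⟩).mono
        (Icc_subset_Icc_left ht₀.1)).continuousWithinAt)
      (fun s hs => ((hx s ⟨ht₀.1.trans hs.1, hs.2.le⟩).mono
        (Icc_subset_Icc_left (ht₀.1.trans hs.1))).mono_of_mem_nhdsWithin
          (Icc_mem_nhdsGE hs.2))
      le_rfl (fun s hs => by simpa using hM s ⟨ht₀.1.trans hs.1, hs.2.le⟩) t ⟨h, ht.2⟩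
    rwa [gronwallBound_ε0, ← abs_of_nonneg (sub_nonneg.2 h)] at this
  -- Times before t₀ are handled by the reflection s ↦ -s.
  · have hmap : ∀ s ∈ Icc (-t₀) (-a), -s ∈ Icc a b := fun s hs =>
      ⟨by linarith [hs.2], by linarith [hs.1, ht₀.2]⟩
    have hd : ∀ s ∈ Icc (-t₀) (-a),
        HasDerivWithinAt (fun s => x (-s)) (-x' (-s)) (Icc (-t₀) (-a)) s := by
      intro s hs
      have := (hx (-s) (hmap s hs)).scomp s (hasDerivAt_neg s).hasDerivWithinAt
        (fun u hu => hmap u hu)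
      simpa [Function.comp_def] using this
    have := norm_le_gronwallBound_of_norm_deriv_right_le (f := fun s => x (-s))
      (f' := fun s => -x' (-s)) (K := M) (ε := 0) (δ := ‖x t₀‖) (a := -t₀) (b := -a)
      (fun s hs => (hd s hs).continuousWithinAt)
      (fun s hs => ((hd s ⟨hs.1, hs.2.le⟩).mono
        (Icc_subset_Icc_left hs.1)).mono_of_mem_nhdsWithin (Icc_mem_nhdsGE hs.2))
      (by simp) (fun s hs => by simpa using hM (-s) (hmap s ⟨hs.1, hs.2.le⟩)) (-t)
      ⟨by linarith, by linarith [ht.1]⟩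
    rw [gronwallBound_ε0, neg_neg] at this
    rwa [abs_of_nonpos (sub_nonpos.2 h), show -(t - t₀) = -t - -t₀ by ring]

lemma linear_ode_unique_Icc {a b t₀ : ℝ} (ht₀ : t₀ ∈ Icc a b) {A : ℝ → X →L[ℝ] X}
    (hA : ContinuousOn A (Icc a b)) {x y : ℝ → X}
    (hx : ∀ t ∈ Icc a b, HasDerivWithinAt x (A t (x t)) (Icc a b) t)
    (hy : ∀ t ∈ Icc a b, HasDerivWithinAt y (A t (y t)) (Icc a b) t)
    (h : x t₀ = y t₀) {t : ℝ} (ht : t ∈ Icc a b) : x t = y t := by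
  obtain ⟨M, hM⟩ := isCompact_Icc.exists_bound_of_continuousOn hA
  have := norm_le_exp_of_norm_deriv_le (x := fun t => x t - y t) (M := M) ht₀
    (fun s hs => (hx s hs).sub (hy s hs)) (fun s hs => by
      rw [← map_sub]
      exact ((A s).le_opNorm _).trans (mul_le_mul_of_nonneg_right (hM s hs) (norm_nonneg _))) ht
  rw [h, sub_self, norm_zero, zero_mul] at this
  exact sub_eq_zero.1 (norm_le_zero_iff.1 this)

variable [CompleteSpace X]

/-- Linear equations have solutions on every compact interval. -/
lemma exists_linear_ode_Icc {a b t₀ : ℝ} (ht₀ : t₀ ∈ Icc a b) {A : ℝ → X →L[ℝ] X}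
    (hA : ContinuousOn A (Icc a b)) (x₀ : X) :
    ∃ x : ℝ → X, x t₀ = x₀ ∧ ∀ t ∈ Icc a b, HasDerivWithinAt x (A t (x t)) (Icc a b) t := by
  obtain ⟨M', hM'⟩ := isCompact_Icc.exists_bound_of_continuousOn hA
  set M : ℝ≥0 := M'.toNNReal
  have hM : ∀ t ∈ Icc a b, ‖A t‖ ≤ M := fun t ht => (hM' t ht).trans (Real.le_coe_toNNReal _)
  -- `R` exceeds the Grönwall bound for solutions starting at `x₀`; the summand 1 keeps it positive
  -- when `x₀ = 0`.
  set R : ℝ≥0 := ⟨(‖x₀‖ + 1) * Real.exp (M * (b - a)), by positivity⟩ with hRdef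
  have hR : (0 : ℝ) < R := by
    change 0 < (‖x₀‖ + 1) * Real.exp (M * (b - a))
    positivity
  have hab : a ≤ b := ht₀.1.trans ht₀.2
  set T : ℝ≥0 := ⟨b - a, sub_nonneg.2 hab⟩
  -- Clamping makes the field bounded by M R and 2M-Lipschitz on the whole space. The radius M R T
  -- then allows the full interval, with no smallness condition on its length.
  have hPL : IsPicardLindelof (fun t x => A t (clampNorm R x)) (⟨t₀, ht₀⟩ : Icc a b) x₀
      (M * R * T) 0 (M * R) (M * 2) :=
    { lipschitzOnWith := fun t ht => by
        refine (LipschitzWith.weaken ((A t).lipschitz.comp (lipschitzWith_clampNorm hR)) ?_).lipschitzOnWith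
        gcongr
        exact hM t ht
      continuousOn := fun x _ => hA.clm_apply continuousOn_const
      norm_le := fun t ht x _ => by
        refine ((A t).le_opNorm _).trans ?_
        push_cast
        exact mul_le_mul (hM t ht) (norm_clampNorm_le hR x) (norm_nonneg _) M.2
      mul_max_le := by
        push_cast
        rw [sub_zero]
        refine mul_le_mul_of_nonneg_left ?_ (by positivity)
        exact max_le (sub_le_sub_left ht₀.1 _) (sub_le_sub_right ht₀.2 _) }
  obtain ⟨x, hx0, hx⟩ := hPL.exists_eq_forall_mem_Icc_hasDerivWithinAt₀
  refine ⟨x, hx0, fun t ht => ?_⟩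
  -- Since clamping never increases the norm, Grönwall applies to the clamped solution too. It stays
  -- in the ball of radius `R`, where clamping does nothing.
  have hle : ‖x t‖ ≤ R := by
    have h1 := norm_le_exp_of_norm_deriv_le (M := M) ht₀ hx (fun s hs =>
      ((A s).le_opNorm _).trans (mul_le_mul (hM s hs) (norm_clampNorm_le_norm hR _)
        (norm_nonneg _) M.2)) ht
    refine h1.trans ?_
    change _ ≤ (‖x₀‖ + 1) * Real.exp (M * (b - a))
    have hx0' : x t₀ = x₀ := hx0
    rw [hx0']
    have : |t - t₀| ≤ b - a := by
      rw [abs_le]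
      constructor <;> linarith [ht.1, ht.2, ht₀.1, ht₀.2]
    gcongr
    linarith
  have := hx t ht
  rwa [clampNorm_of_norm_le hR hle] at this

/-- Linear equations have solutions on every interval. -/
theorem exists_linear_ode {J : Set ℝ} (hJ : J.OrdConnected) {t₀ : ℝ} (ht₀ : t₀ ∈ J)
    {A : ℝ → X →L[ℝ] X} (hA : ContinuousOn A J) (x₀ : X) :
    ∃ x : ℝ → X, x t₀ = x₀ ∧ ∀ t ∈ J, HasDerivWithinAt x (A t (x t)) J t := by
  have hsub : ∀ {a b}, a ∈ J → b ∈ J → Icc a b ⊆ J := fun ha hb => hJ.out ha hb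
  have hex : ∀ a b, a ∈ J → b ∈ J → t₀ ∈ Icc a b → ∃ x : ℝ → X, x t₀ = x₀ ∧
      ∀ t ∈ Icc a b, HasDerivWithinAt x (A t (x t)) (Icc a b) t := fun a b ha hb h =>
    exists_linear_ode_Icc h (hA.mono (hsub ha hb)) x₀
  choose! x hx0 hx using hex
  have hmin : ∀ t ∈ J, min t₀ t ∈ J := fun t ht => by
    rcases min_choice t₀ t with h | h <;> rw [h] <;> assumption
  have hmax : ∀ t ∈ J, max t₀ t ∈ J := fun t ht => by
    rcases max_choice t₀ t with h | h <;> rw [h] <;> assumption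
  have hmem : ∀ t, t₀ ∈ Icc (min t₀ t) (max t₀ t) := fun t => ⟨min_le_left _ _, le_max_left _ _⟩
  -- The value at `t` is taken from the solution on the compact interval between t₀ and `t`;
  -- uniqueness makes all these solutions agree.
  let y : ℝ → X := fun t => x (min t₀ t) (max t₀ t) t
  have hy : ∀ a b, a ∈ J → b ∈ J → t₀ ∈ Icc a b → ∀ t ∈ Icc a b, y t = x a b t := by
    intro a b ha hb h t ht
    have htJ : t ∈ J := hsub ha hb ht
    have hs : Icc (min t₀ t) (max t₀ t) ⊆ Icc a b :=
      Icc_subset_Icc (le_min h.1 ht.1) (max_le h.2 ht.2)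
    refine linear_ode_unique_Icc (hmem t) (hA.mono (hsub (hmin t htJ) (hmax t htJ)))
      (hx _ _ (hmin t htJ) (hmax t htJ) (hmem t))
      (fun s hs' => (hx a b ha hb h s (hs hs')).mono hs) ?_ ⟨min_le_right _ _, le_max_right _ _⟩
    rw [hx0 _ _ (hmin t htJ) (hmax t htJ) (hmem t), hx0 a b ha hb h]
  refine ⟨y, ?_, fun t ht => ?_⟩
  · have := hx0 _ _ (hmin t₀ ht₀) (hmax t₀ ht₀) (hmem t₀)
    exact this
  -- A compact interval [a, b] in `J` is needed that contains t₀ and is a neighbourhood of `t`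
  -- relative to `J`. An end of it may coincide with `t` only if `t` is an endpoint of `J`.
  · obtain ⟨a, ha, hat, ha'⟩ : ∃ a ∈ J, a ≤ min t₀ t ∧ (a < t ∨ ∀ s ∈ J, t ≤ s) := by
      by_cases h : ∃ s ∈ J, s < t
      · obtain ⟨s, hs, hst⟩ := h
        refine ⟨min t₀ s, hmin s hs, min_le_min_left _ hst.le, Or.inl ((min_le_right _ _).trans_lt hst)⟩
      · push Not at h
        exact ⟨min t₀ t, hmin t ht, le_rfl, Or.inr h⟩
    obtain ⟨b, hb, htb, hb'⟩ : ∃ b ∈ J, max t₀ t ≤ b ∧ (t < b ∨ ∀ s ∈ J, s ≤ t) := by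
      by_cases h : ∃ s ∈ J, t < s
      · obtain ⟨s, hs, hst⟩ := h
        refine ⟨max t₀ s, hmax s hs, max_le_max_left _ hst.le, Or.inl (hst.trans_le (le_max_right _ _))⟩
      · push Not at h
        exact ⟨max t₀ t, hmax t ht, le_rfl, Or.inr h⟩
    have h0 : t₀ ∈ Icc a b := ⟨hat.trans (min_le_left _ _), (le_max_left _ _).trans htb⟩
    have h1 : t ∈ Icc a b := ⟨hat.trans (min_le_right _ _), (le_max_right _ _).trans htb⟩
    have hnhds : Icc a b ∈ 𝓝[J] t := by
      have hA1 : ∀ᶠ s in 𝓝[J] t, a ≤ s := by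
        rcases ha' with h | h
        · exact mem_nhdsWithin_of_mem_nhds (Ici_mem_nhds h)
        · filter_upwards [self_mem_nhdsWithin] with s hs using h1.1.trans (h s hs)
      have hB1 : ∀ᶠ s in 𝓝[J] t, s ≤ b := by
        rcases hb' with h | h
        · exact mem_nhdsWithin_of_mem_nhds (Iic_mem_nhds h)
        · filter_upwards [self_mem_nhdsWithin] with s hs using (h s hs).trans h1.2
      filter_upwards [hA1, hB1] with s h2 h3 using ⟨h2, h3⟩
    have h2 := hx a b ha hb h0 t h1
    rw [← hy a b ha hb h0 t h1] at h2
    exact (h2.congr (fun s hs => hy a b ha hb h0 s hs) (hy a b ha hb h0 t h1)).mono_of_mem_nhdsWithin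
      hnhds

/-- Local existence at interior points and at endpoints of an interval. -/
theorem exists_local_ode {I : Set ℝ} (hI : I.OrdConnected) (hI' : I.Nontrivial) {t₀ : ℝ}
    (ht₀ : t₀ ∈ I) {F : ℝ → X → X} (hF : ContinuousOn (fun q : ℝ × X => F q.1 q.2) (I ×ˢ univ))
    (x₀ : X)
    (hL : ∀ a b, Icc a b ⊆ I → ∃ C : ℝ≥0, ∀ t ∈ Icc a b,
      LipschitzOnWith C (F t) (Metric.closedBall x₀ 1)) :
    ∃ J ⊆ I, J.OrdConnected ∧ J.Nontrivial ∧ J ∈ 𝓝[I] t₀ ∧ t₀ ∈ J ∧ ∃ x : ℝ → X, x t₀ = x₀ ∧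
      ∀ t ∈ J, HasDerivWithinAt x (F t (x t)) J t := by
  obtain ⟨a, ha, hat, ha'⟩ : ∃ a ∈ I, a ≤ t₀ ∧ (a < t₀ ∨ ∀ s ∈ I, t₀ ≤ s) := by
    by_cases h : ∃ s ∈ I, s < t₀
    · obtain ⟨s, hs, hst⟩ := h
      exact ⟨s, hs, hst.le, Or.inl hst⟩
    · push Not at h
      exact ⟨t₀, ht₀, le_rfl, Or.inr h⟩
  obtain ⟨b, hb, htb, hb'⟩ : ∃ b ∈ I, t₀ ≤ b ∧ (t₀ < b ∨ ∀ s ∈ I, s ≤ t₀) := by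
    by_cases h : ∃ s ∈ I, t₀ < s
    · obtain ⟨s, hs, hst⟩ := h
      exact ⟨s, hs, hst.le, Or.inl hst⟩
    · push Not at h
      exact ⟨t₀, ht₀, le_rfl, Or.inr h⟩
  have hab : a < b := by
    rcases ha' with h | h
    · exact h.trans_le htb
    · rcases hb' with h' | h'
      · exact hat.trans_lt h'
      · obtain ⟨s, hs, hst⟩ := hI'.exists_ne t₀
        exact absurd (le_antisymm (h' s hs) (h s hs)) hst
  have hsub : Icc a b ⊆ I := hI.out ha hb
  obtain ⟨C, hC⟩ := hL a b hsub
  have hFx : ∀ x, ContinuousOn (F · x) (Icc a b) := fun x =>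
    hF.comp (f := fun t => (t, x)) (by fun_prop) (fun t ht => ⟨hsub ht, mem_univ _⟩)
  obtain ⟨B, hB⟩ := isCompact_Icc.exists_bound_of_continuousOn (hFx x₀)
  -- Bound at the centre plus Lipschitz constant times the radius 1. With ε = 1/(L + 1), the
  -- solution cannot leave the unit ball within time ε.
  set L : ℝ≥0 := B.toNNReal + C
  have hLb : ∀ t ∈ Icc a b, ∀ x ∈ Metric.closedBall x₀ (1 : ℝ), ‖F t x‖ ≤ L := by
    intro t ht x hx
    have h1 := (hC t ht).dist_le_mul x hx x₀ (Metric.mem_closedBall_self zero_le_one)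
    rw [dist_eq_norm] at h1
    have h2 := hB t ht
    have h3 : (C : ℝ) * dist x x₀ ≤ C := mul_le_of_le_one_right C.2 hx
    have h4 := norm_le_norm_add_norm_sub' (F t x) (F t x₀)
    have h5 := Real.le_coe_toNNReal B
    simp only [L, NNReal.coe_add]
    linarith
  set ε : ℝ := 1 / (L + 1)
  have hL0 : (0 : ℝ) ≤ L := L.2
  have hε : 0 < ε := by positivity
  set c := max a (t₀ - ε)
  set d := min b (t₀ + ε)
  have hcd : Icc c d ⊆ Icc a b := Icc_subset_Icc (le_max_left _ _) (min_le_left _ _)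
  have ht₀' : t₀ ∈ Icc c d := ⟨max_le hat (by linarith), le_min htb (by linarith)⟩
  have hcd' : c < d := by
    rcases ha' with h | h
    · exact (max_lt h (by linarith)).trans_le ht₀'.2
    · rcases hb' with h' | h'
      · exact ht₀'.1.trans_lt (lt_min h' (by linarith))
      · obtain ⟨s, hs, hst⟩ := hI'.exists_ne t₀
        exact absurd (le_antisymm (h' s hs) (h s hs)) hst
  have hPL : IsPicardLindelof F (⟨t₀, ht₀'⟩ : Icc c d) x₀ 1 0 L C :=
    { lipschitzOnWith := fun t ht => by simpa using hC t (hcd ht)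
      continuousOn := fun x _ => (hFx x).mono hcd
      norm_le := fun t ht x hx => hLb t (hcd ht) x (by simpa using hx)
      mul_max_le := by
        simp only [NNReal.coe_one, NNReal.coe_zero, sub_zero]
        have h1 : max (d - t₀) (t₀ - c) ≤ ε := max_le (by linarith [min_le_right b (t₀ + ε)])
          (by linarith [le_max_right a (t₀ - ε)])
        refine (mul_le_mul_of_nonneg_left h1 hL0).trans ?_
        rw [mul_one_div, div_le_one (by positivity)]
        linarith }
  obtain ⟨x, hx0, hx⟩ := hPL.exists_eq_forall_mem_Icc_hasDerivWithinAt₀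
  refine ⟨Icc c d, hcd.trans hsub, ordConnected_Icc, ⟨c, left_mem_Icc.2 hcd'.le, d, right_mem_Icc.2 hcd'.le, hcd'.ne⟩, ?_, ht₀', x, hx0, hx⟩
  have hA1 : ∀ᶠ s in 𝓝[I] t₀, c ≤ s := by
    have h2 : ∀ᶠ s in 𝓝[I] t₀, t₀ - ε ≤ s := mem_nhdsWithin_of_mem_nhds (Ici_mem_nhds (show t₀ - ε < t₀ by linarith))
    rcases ha' with h | h
    · filter_upwards [h2, mem_nhdsWithin_of_mem_nhds (Ici_mem_nhds h)] with s h3 h4 using max_le h4 h3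
    · filter_upwards [h2, self_mem_nhdsWithin] with s h3 hs using max_le (hat.trans (h s hs)) h3
  have hB1 : ∀ᶠ s in 𝓝[I] t₀, s ≤ d := by
    have h2 : ∀ᶠ s in 𝓝[I] t₀, s ≤ t₀ + ε := mem_nhdsWithin_of_mem_nhds (Iic_mem_nhds (show t₀ < t₀ + ε by linarith))
    rcases hb' with h | h
    · filter_upwards [h2, mem_nhdsWithin_of_mem_nhds (Iic_mem_nhds h)] with s h3 h4 using le_min h4 h3
    · filter_upwards [h2, self_mem_nhdsWithin] with s h3 hs using le_min ((h s hs).trans htb) h3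
  filter_upwards [hA1, hB1] with s h2 h3 using ⟨h2, h3⟩

end ODE

end HodgeLDG

namespace HodgeLDG

/-! ### Geometry of meshes -/

namespace PolyhedralMesh

variable {n : ℕ} (M : PolyhedralMesh n) {K L e : Set (E n)}

lemma interior_cell_nonempty (hK : K ∈ M.cells) : (interior K).Nonempty := by
  rw [← closure_nonempty_iff, M.closure_interior_cell K hK]
  exact M.nonempty_cell K hK

lemma normal_ne_zero (hK : K ∈ M.cells) (he : e ∈ M.facets K) : M.normal K e ≠ 0 := by
  rw [← norm_pos_iff, M.norm_normal K hK e he]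
  exact one_pos

lemma intrinsicInterior_facet_nonempty (hK : K ∈ M.cells) (he : e ∈ M.facets K) :
    (intrinsicInterior ℝ e).Nonempty := by
  rw [← closure_nonempty_iff, M.closure_intrinsicInterior_facet K hK e he]
  exact M.nonempty_facet K hK e he

lemma facet_measure_ne_zero (hK : K ∈ M.cells) (he : e ∈ M.facets K) :
    Measure.euclideanHausdorffMeasure (n - 1) e ≠ 0 :=
  (facet_measure (M.isCompact_facet K hK e he) (M.norm_normal K hK e he)
    (M.vectorSpan_facet K hK e he) (M.intrinsicInterior_facet_nonempty hK he)).1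

lemma facet_measure_ne_top (hK : K ∈ M.cells) (he : e ∈ M.facets K) :
    Measure.euclideanHausdorffMeasure (n - 1) e ≠ ⊤ :=
  (facet_measure (M.isCompact_facet K hK e he) (M.norm_normal K hK e he)
    (M.vectorSpan_facet K hK e he) (M.intrinsicInterior_facet_nonempty hK he)).2

/-- Without facets a cell would have empty frontier and be both open and closed. It would be empty
or all of ℝⁿ, and the latter is not compact for n ≥ 1. -/
lemma exists_facet (hn : 1 ≤ n) (hK : K ∈ M.cells) : ∃ e, e ∈ M.facets K := by
  by_contra! h
  have hf : frontier K = ∅ := by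
    rw [M.frontier_cell K hK]
    simp [h]
  have : Nonempty (Fin n) := ⟨⟨0, hn⟩⟩
  rcases isClopen_iff.1 (isClopen_iff_frontier_eq_empty.2 hf) with h0 | h0
  · exact (M.nonempty_cell K hK).ne_empty h0
  · have h1 := M.isCompact_cell K hK
    rw [h0] at h1
    exact noncompact_univ (E n) h1

/-- Both unit normals span the orthogonal complement of the facet, so they agree up to sign. If they
were equal, points just behind the facet would lie in the interiors of both cells. -/
lemma normal_eq_neg (hK : K ∈ M.cells) (hL : L ∈ M.cells) (hKL : K ≠ L) (he : e ∈ M.facets K)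
    (he' : e ∈ M.facets L) : M.normal L e = -M.normal K e := by
  have hspan : Submodule.span ℝ {M.normal K e} = Submodule.span ℝ {M.normal L e} := by
    rw [← Submodule.orthogonal_orthogonal (Submodule.span ℝ {M.normal K e}),
      ← M.vectorSpan_facet K hK e he, M.vectorSpan_facet L hL e he',
      Submodule.orthogonal_orthogonal]
  have hmem : M.normal L e ∈ Submodule.span ℝ {M.normal K e} := by
    rw [hspan]
    exact Submodule.mem_span_singleton_self _
  obtain ⟨c, hc⟩ := Submodule.mem_span_singleton.1 hmem
  have hc1 : |c| = 1 := by
    have := M.norm_normal L hL e he'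
    rwa [← hc, norm_smul, M.norm_normal K hK e he, mul_one, Real.norm_eq_abs] at this
  rcases (abs_eq zero_le_one).1 hc1 with rfl | rfl
  · exfalso
    rw [one_smul] at hc
    obtain ⟨x, hx⟩ := M.intrinsicInterior_facet_nonempty hK he
    obtain ⟨s, hs, hs'⟩ := ((M.normal_outward K hK e he x hx).and
      (M.normal_outward L hL e he' x hx)).exists
    rw [← hc] at hs'
    exact (M.disjoint_cells K hK L hL hKL).le_bot ⟨hs.2, hs'.2⟩
  · rw [← hc, neg_one_smul]

lemma contract_normal_eq_zero (hK : K ∈ M.cells) (hL : L ∈ M.cells) (he : e ∈ M.facets K)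
    (he' : e ∈ M.facets L) {a : Alt n} (ha : contract (M.normal L e) a = 0) :
    contract (M.normal K e) a = 0 := by
  rcases eq_or_ne K L with rfl | h
  · exact ha
  · rwa [M.normal_eq_neg hK hL h he he', contract_neg_left, neg_eq_zero] at ha

open scoped Classical in
/-- The cells that have `e` as a facet. -/
noncomputable def sides (e : Set (E n)) : Finset (Set (E n)) :=
  M.cells.filter fun K => e ∈ M.facets K

lemma mem_sides : K ∈ M.sides e ↔ K ∈ M.cells ∧ e ∈ M.facets K := by
  simp [sides]

open scoped Classical in
/-- An interior facet is shared by exactly two cells. -/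
lemma sides_eq_pair (hK : K ∈ M.cells) (hL : L ∈ M.cells) (hKL : K ≠ L) (he : e ∈ M.facets K)
    (he' : e ∈ M.facets L) : M.sides e = {K, L} := by
  ext A
  simp only [mem_sides, Finset.mem_insert, Finset.mem_singleton]
  constructor
  · rintro ⟨hA, heA⟩
    -- Three cells sharing a facet would have pairwise opposite normals, giving ν = -ν.
    by_contra! h
    have h1 := M.normal_eq_neg hK hL hKL he he'
    have h2 := M.normal_eq_neg hK hA h.1.symm he heA
    have h3 := M.normal_eq_neg hL hA h.2.symm he' heA
    rw [h2, h1, neg_neg] at h3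
    have h4 := M.normal_ne_zero hK he
    have h5 : (2 : ℝ) • M.normal K e = 0 := by
      calc (2 : ℝ) • M.normal K e = -M.normal K e + M.normal K e := by rw [two_smul, h3]
        _ = 0 := neg_add_cancel _
    exact h4 ((smul_eq_zero.1 h5).resolve_left two_ne_zero)
  · rintro (rfl | rfl)
    · exact ⟨hK, he⟩
    · exact ⟨hL, he'⟩

lemma setIntegral_facet_congr (hK : K ∈ M.cells) (he : e ∈ M.facets K) {f g : E n → ℝ}
    (h : ∀ x ∈ e, f x = g x) : ∫ x, f x ∂(surface e) = ∫ x, g x ∂(surface e) :=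
  setIntegral_congr_fun (M.isCompact_facet K hK e he).measurableSet h

lemma bdryInner_congr (hK : K ∈ M.cells) {a a' b b' : Trace n}
    (ha : ∀ e ∈ M.facets K, ∀ x ∈ e, a K e x = a' K e x)
    (hb : ∀ e ∈ M.facets K, ∀ x ∈ e, b K e x = b' K e x) :
    M.bdryInner K a b = M.bdryInner K a' b' :=
  Finset.sum_congr rfl fun e he => M.setIntegral_facet_congr hK he fun x hx => by
    rw [ha e he x hx, hb e he x hx]

@[simp] lemma bdryInner_zero_left (b : Trace n) : M.bdryInner K 0 b = 0 := by
  simp [bdryInner]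

@[simp] lemma bdryInner_zero_right (a : Trace n) : M.bdryInner K a 0 = 0 := by
  simp [bdryInner]

/-- The boundary inner product of traces that are constant on one facet and whose product vanishes
on the others. -/
lemma bdryInner_single (hK : K ∈ M.cells) (he : e ∈ M.facets K) {a b : Trace n} {c : ℝ}
    (hc : ∀ x ∈ e, ⟪a K e x, b K e x⟫ = c)
    (h0 : ∀ e' ∈ M.facets K, e' ≠ e → ∀ x ∈ e', ⟪a K e' x, b K e' x⟫ = 0) :
    M.bdryInner K a b = (Measure.euclideanHausdorffMeasure (n - 1) e).toReal * c := by
  unfold bdryInner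
  rw [Finset.sum_eq_single_of_mem e he]
  · rw [M.setIntegral_facet_congr hK he hc]
    simp [surface, Measure.real]
  · intro e' he' hne
    rw [M.setIntegral_facet_congr hK he' (h0 e' he' hne), integral_zero]

lemma facet_measure_toReal_pos (hK : K ∈ M.cells) (he : e ∈ M.facets K) :
    0 < (Measure.euclideanHausdorffMeasure (n - 1) e).toReal :=
  ENNReal.toReal_pos (M.facet_measure_ne_zero hK he) (M.facet_measure_ne_top hK he)

/-- Traces with opposite values on the two sides are orthogonal to single-valued traces that vanish
on the boundary. -/
lemma skelInner_eq_zero {a b : Trace n} {r : ℕ} {j : ℤ} (ha : M.IsSingleValuedNor a)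
    (hb : M.IsVhat0 r j b) : M.skelInner a b = 0 := by
  classical
  -- The involution crosses each interior facet: the two contributions of the facet cancel, and
  -- those of boundary facets vanish.
  let partner : Set (E n) → Set (E n) → Set (E n) := fun K e =>
    if h : ∃ L ∈ M.cells, L ≠ K ∧ e ∈ M.facets L then h.choose else K
  have hp : ∀ K e, (∃ L ∈ M.cells, L ≠ K ∧ e ∈ M.facets L) →
      partner K e ∈ M.cells ∧ partner K e ≠ K ∧ e ∈ M.facets (partner K e) := by
    intro K e h
    simp only [partner, dif_pos h]
    exact h.choose_spec
  have hp' : ∀ K e, (¬ ∃ L ∈ M.cells, L ≠ K ∧ e ∈ M.facets L) → partner K e = K := by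
    intro K e h
    simp only [partner, dif_neg h]
  have hz : ∀ K ∈ M.cells, ∀ e ∈ M.facets K, (¬ ∃ L ∈ M.cells, L ≠ K ∧ e ∈ M.facets L) →
      ∫ x, ⟪a K e x, b K e x⟫ ∂(surface e) = 0 := by
    intro K hK e he h
    rw [M.setIntegral_facet_congr hK he (g := fun _ => 0), integral_zero]
    intro x hx
    rw [hb.2 K hK e he ?_ x hx, inner_zero_right]
    intro L hL heL
    by_contra hne
    exact h ⟨L, hL, hne, heL⟩
  unfold skelInner bdryInner
  rw [Finset.sum_sigma']
  refine Finset.sum_involution (fun q _ => ⟨partner q.1 q.2, q.2⟩) ?_ ?_ ?_ ?_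
  · rintro ⟨K, e⟩ hq
    obtain ⟨hK, he⟩ := Finset.mem_sigma.1 hq
    dsimp only at hK he ⊢
    by_cases h : ∃ L ∈ M.cells, L ≠ K ∧ e ∈ M.facets L
    · obtain ⟨hL, hne, heL⟩ := hp K e h
      rw [M.setIntegral_facet_congr hL heL (f := fun x => ⟪a (partner K e) e x, b (partner K e) e x⟫)
        (g := fun x => -⟪a K e x, b K e x⟫), integral_neg,
        add_neg_cancel]
      intro x hx
      rw [hb.1.2 _ hL K hK e heL he x hx,
        eq_neg_of_add_eq_zero_right (ha K hK _ hL hne.symm e he heL x hx), inner_neg_left]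
    · rw [hp' K e h, hz K hK e he h, add_zero]
  · rintro ⟨K, e⟩ hq hne heq
    obtain ⟨hK, he⟩ := Finset.mem_sigma.1 hq
    refine hne (hz K hK e he fun h => (hp K e h).2.1 ?_)
    exact congrArg Sigma.fst heq
  · rintro ⟨K, e⟩ hq
    obtain ⟨hK, he⟩ := Finset.mem_sigma.1 hq
    by_cases h : ∃ L ∈ M.cells, L ≠ K ∧ e ∈ M.facets L
    · obtain ⟨hL, hne, heL⟩ := hp K e h
      exact Finset.mem_sigma.2 ⟨hL, heL⟩
    · rw [hp' K e h]
      exact hq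
  · rintro ⟨K, e⟩ hq
    obtain ⟨hK, he⟩ := Finset.mem_sigma.1 hq
    dsimp only at hK he ⊢
    by_cases h : ∃ L ∈ M.cells, L ≠ K ∧ e ∈ M.facets L
    · obtain ⟨hL, hne, heL⟩ := hp K e h
      obtain ⟨hA, hneA, heA⟩ := hp (partner K e) e ⟨K, hK, hne.symm, he⟩
      have h1 : partner (partner K e) e ∈ M.sides e := M.mem_sides.2 ⟨hA, heA⟩
      rw [M.sides_eq_pair hK hL hne.symm he heL, Finset.mem_insert, Finset.mem_singleton] at h1
      rw [h1.resolve_right hneA]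
    · rw [hp' K e h, hp' K e h]

end PolyhedralMesh

/-! ### Signs of the penalties -/

section Signs

variable {n : ℕ} (M : PolyhedralMesh n) {K e : Set (E n)}

/-- L² traces may live on one side of one facet, so definiteness of a penalty localizes to the sign
of each scalar. The restriction j < n is essential: an (n-1)-dimensional facet carries no n-forms.
-/
lemma exists_isL2Trace_single (hK : K ∈ M.cells) (he : e ∈ M.facets K) {j : ℕ} (hj : j < n) :
    ∃ w : Trace n, M.IsL2Trace j w ∧ ∃ c : ℝ, 0 < c ∧
      ∀ β : Penalty n, M.skelInner (β.act w) w = β K e * c := by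
  classical
  obtain ⟨b, hb, hb0⟩ := exists_tanTr_ne_zero (M.normal_ne_zero hK he) hj
  set a := tanTr (M.normal K e) b with ha
  refine ⟨fun K' e' _ => if K' = K ∧ e' = e then a else 0, ?_,
    (Measure.euclideanHausdorffMeasure (n - 1) e).toReal * ‖a‖ ^ 2,
    mul_pos (M.facet_measure_toReal_pos hK he) (by positivity), fun β => ?_⟩
  · intro K' hK' e' he'
    refine ⟨memLp_of_continuous (M.isCompact_facet K' hK' e' he')
      (M.facet_measure_ne_top hK' he') continuous_const, fun x _ => ?_⟩
    dsimp only
    split_ifs with h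
    · obtain ⟨rfl, rfl⟩ := h
      exact ⟨hb.tanTr _, contract_tanTr _ _⟩
    · exact ⟨HasDegree.zero _, (contractL _).map_zero⟩
  · unfold PolyhedralMesh.skelInner
    rw [Finset.sum_eq_single_of_mem K hK]
    · rw [M.bdryInner_single hK he (c := β K e * ‖a‖ ^ 2)]
      · ring
      · intro x _
        simp [Penalty.act, real_inner_smul_left]
      · intro e' _ hne x _
        simp [hne]
    · intro K' _ hne
      simp [PolyhedralMesh.bdryInner, hne]

lemma Penalty.IsPosDef.pos {j : ℕ} (hj : j < n) {α : Penalty n} (hα : α.IsPosDef M j)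
    (hK : K ∈ M.cells) (he : e ∈ M.facets K) : 0 < α K e := by
  obtain ⟨w, hw, c, hc, h⟩ := exists_isL2Trace_single M hK he hj
  have h1 := h (fun _ _ => 1)
  have h2 : (Penalty.act (fun _ _ => 1) w : Trace n) = w := by
    funext K e x
    simp [Penalty.act]
  rw [h2, one_mul] at h1
  have h3 := hα w hw (h1 ▸ hc)
  rw [h] at h3
  exact pos_of_mul_pos_left h3 hc.le

lemma Penalty.IsNegDef.neg {j : ℕ} (hj : j < n) {α : Penalty n} (hα : α.IsNegDef M j)
    (hK : K ∈ M.cells) (he : e ∈ M.facets K) : α K e < 0 := by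
  obtain ⟨w, hw, c, hc, h⟩ := exists_isL2Trace_single M hK he hj
  have h1 := h (fun _ _ => 1)
  have h2 : (Penalty.act (fun _ _ => 1) w : Trace n) = w := by
    funext K e x
    simp [Penalty.act]
  rw [h2, one_mul] at h1
  have h3 := hα w hw (h1 ▸ hc)
  rw [h] at h3
  exact neg_of_mul_neg_left h3 hc.le

end Signs

/-! ### Numerical traces -/

section Flux

variable {n r : ℕ} {j j' : ℤ}

/-- Apply a linear map to the values of a polynomial form; the result is linear in the form. -/
def formMap (r : ℕ) (j : ℤ) (L : Alt n →ₗ[ℝ] Alt n) : PolyForm n r j →ₗ[ℝ] (E n → Alt n) :=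
  L.compLeft (E n) ∘ₗ PolyForm.toFormL

lemma continuous_formMap (L : Alt n →ₗ[ℝ] Alt n) (c : PolyForm n r j) :
    Continuous (formMap r j L c) :=
  (LinearMap.continuous_of_finiteDimensional L).comp c.continuous_toForm

lemma formMap_mem_range {L : Alt n →ₗ[ℝ] Alt n} (hL : ∀ a, HasDegree j a → HasDegree j' (L a))
    (c : PolyForm n r j) :
    formMap r j L c ∈ LinearMap.range (PolyForm.toFormL : PolyForm n r j' →ₗ[ℝ] _) :=
  ⟨PolyForm.mapForm L c, funext fun x => PolyForm.toForm_mapForm hL c x⟩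

variable (M : PolyhedralMesh n) (c : Set (E n) → ℝ) (α : Penalty n)

/-- The numerical trace on the facet `e`: the weighted sum of `α w^tan + q^nor` over the cells that
have `e` as a facet. -/
noncomputable def flux (r : ℕ) (j j' : ℤ) (e : Set (E n)) :
    Broken n r j × Broken n r j' →ₗ[ℝ] (E n → Alt n) :=
  c e • ∑ L ∈ M.sides e,
    (α L e • (formMap r j (tanTrL (M.normal L e)) ∘ₗ LinearMap.proj L ∘ₗ LinearMap.fst ℝ _ _) +
      formMap r j' (contractL (M.normal L e)) ∘ₗ LinearMap.proj L ∘ₗ LinearMap.snd ℝ _ _)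

/-- The normal trace `q^nor - α (ŵ - w^tan)` of the numerical trace `ŵ`. -/
noncomputable def fluxNor (r : ℕ) (j j' : ℤ) (K e : Set (E n)) :
    Broken n r j × Broken n r j' →ₗ[ℝ] (E n → Alt n) :=
  formMap r j' (contractL (M.normal K e)) ∘ₗ LinearMap.proj K ∘ₗ LinearMap.snd ℝ _ _ -
    α K e • (flux M c α r j j' e -
      formMap r j (tanTrL (M.normal K e)) ∘ₗ LinearMap.proj K ∘ₗ LinearMap.fst ℝ _ _)

lemma flux_apply (e : Set (E n)) (w : Broken n r j) (q : Broken n r j') (x : E n) :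
    flux M c α r j j' e (w, q) x =
      c e • ∑ L ∈ M.sides e, (α L e • M.tan w L e x + M.nor q L e x) := by
  simp only [flux, LinearMap.smul_apply, LinearMap.sum_apply, Pi.smul_apply, Finset.sum_apply]
  rfl

lemma fluxNor_apply (K e : Set (E n)) (w : Broken n r j) (q : Broken n r j') (x : E n) :
    fluxNor M c α r j j' K e (w, q) x =
      M.nor q K e x - α K e • (flux M c α r j j' e (w, q) x - M.tan w K e x) := rfl

variable {M c α} {K L e : Set (E n)}

lemma flux_mem_range (hj : j' = j + 1) (e : Set (E n)) (w : Broken n r j × Broken n r j') :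
    flux M c α r j j' e w ∈ LinearMap.range (PolyForm.toFormL : PolyForm n r j →ₗ[ℝ] _) := by
  simp only [flux, LinearMap.smul_apply, LinearMap.sum_apply, LinearMap.add_apply,
    LinearMap.comp_apply]
  refine Submodule.smul_mem _ _ (Submodule.sum_mem _ fun L _ => Submodule.add_mem _
    (Submodule.smul_mem _ _ (formMap_mem_range (fun a ha => ha.tanTr _) _))
    (formMap_mem_range (fun a ha => ?_) _))
  have := HasDegree.contract ha (M.normal L e)
  rwa [hj, add_sub_cancel_right] at this

lemma fluxNor_mem_range (hj : j' = j + 1) (K e : Set (E n)) (w : Broken n r j × Broken n r j') :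
    fluxNor M c α r j j' K e w ∈ LinearMap.range (PolyForm.toFormL : PolyForm n r j →ₗ[ℝ] _) := by
  simp only [fluxNor, LinearMap.sub_apply, LinearMap.smul_apply, LinearMap.comp_apply]
  refine Submodule.sub_mem _ (formMap_mem_range (fun a ha => ?_) _) (Submodule.smul_mem _ _
    (Submodule.sub_mem _ (flux_mem_range hj e w)
      (formMap_mem_range (fun a ha => ha.tanTr _) _)))
  have := HasDegree.contract ha (M.normal K e)
  rwa [hj, add_sub_cancel_right] at this

lemma continuous_of_mem_range {f : E n → Alt n}
    (hf : f ∈ LinearMap.range (PolyForm.toFormL : PolyForm n r j →ₗ[ℝ] _)) : Continuous f := by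
  obtain ⟨p, rfl⟩ := hf
  exact p.continuous_toForm

/-- The normals from the different sides of `e` differ only by sign, so a trace tangential for one
side is tangential for all. -/
lemma contract_flux (hK : K ∈ M.cells) (he : e ∈ M.facets K)
    (w : Broken n r j × Broken n r j') (x : E n) :
    contract (M.normal K e) (flux M c α r j j' e w x) = 0 := by
  rw [← contractL_apply, flux_apply, map_smul, map_sum, Finset.sum_eq_zero, smul_zero]
  intro L hL
  obtain ⟨hL, heL⟩ := M.mem_sides.1 hL
  rw [contractL_apply]
  refine M.contract_normal_eq_zero hK hL he heL ?_
  rw [← contractL_apply, map_add, map_smul, contractL_apply, contractL_apply]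
  change α L e • contract _ (tanTr _ _) + contract _ (norTr _ _) = 0
  rw [contract_tanTr, contract_norTr, smul_zero, add_zero]

lemma isVhat_flux (hj : j' = j + 1) (w : Broken n r j × Broken n r j') :
    M.IsVhat r j fun _ e => flux M c α r j j' e w := by
  refine ⟨fun K hK e he => ?_, fun _ _ _ _ _ _ _ _ _ => rfl⟩
  obtain ⟨p, hp⟩ := flux_mem_range (M := M) (c := c) (α := α) hj e w
  exact ⟨p, fun x _ => ⟨congrFun hp.symm x, contract_flux hK he w x⟩⟩

lemma isL2Trace_fluxNor (hj : j' = j + 1) (w : Broken n r j × Broken n r j') :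
    M.IsL2Trace j fun K e => fluxNor M c α r j j' K e w := by
  intro K hK e he
  obtain ⟨w, q⟩ := w
  have hd := fluxNor_mem_range (M := M) (c := c) (α := α) hj K e (w, q)
  refine ⟨memLp_of_continuous (M.isCompact_facet K hK e he) (M.facet_measure_ne_top hK he)
    (continuous_of_mem_range hd), fun x _ => ?_⟩
  dsimp only
  obtain ⟨p, hp⟩ := hd
  refine ⟨?_, ?_⟩
  · rw [← hp]
    exact p.hasDegree_toForm x
  · have h1 := contract_flux (c := c) (α := α) hK he (w, q) x
    rw [← contractL_apply] at h1 ⊢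
    rw [fluxNor_apply, map_sub, map_smul, map_sub, h1, contractL_apply, contractL_apply]
    change contract _ (norTr _ _) - α K e • (0 - contract _ (tanTr _ _)) = 0
    rw [contract_tanTr, contract_norTr, sub_zero, smul_zero, sub_zero]

variable (M c α) in
/-- The weights for which the normal traces of the numerical traces are single-valued. -/
def IsFluxWeight (j : ℤ) : Prop :=
  ∀ K ∈ M.cells, ∀ L ∈ M.cells, K ≠ L → ∀ e ∈ M.facets K, e ∈ M.facets L →
    c e * (α K e + α L e) = 1 ∨ j < 0 ∨ n ≤ j

lemma isSingleValuedNor_fluxNor (hj : j' = j + 1) (hc : IsFluxWeight M c α j)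
    (w : Broken n r j × Broken n r j') :
    M.IsSingleValuedNor fun K e => fluxNor M c α r j j' K e w := by
  classical
  intro K hK L hL hKL e he heL x _
  dsimp only
  obtain ⟨w, q⟩ := w
  rw [fluxNor_apply, fluxNor_apply, flux_apply, M.sides_eq_pair hK hL hKL he heL,
    Finset.sum_pair hKL]
  rcases hc K hK L hL hKL e he heL with h | h
  · have h1 : (1 - c e * (α K e + α L e)) • (α K e • M.tan w K e x + M.nor q K e x +
        (α L e • M.tan w L e x + M.nor q L e x)) = 0 := by rw [h, sub_self, zero_smul]
    rw [← h1]
    module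
  -- In the extreme degrees all traces vanish for lack of forms, whatever the weight.
  · have h1 : ∀ A, M.tan w A e x = 0 := by
      intro A
      have hd := (w A).hasDegree_toForm x
      rcases h with h | h
      · exact (hd.tanTr (M.normal A e)).eq_zero (Or.inl h)
      · change contractL _ (wedge _ _) = 0
        rw [(hd.wedge (M.normal A e)).eq_zero (Or.inr (by omega)), map_zero]
    have h2 : ∀ A, M.nor q A e x = 0 := by
      intro A
      have hd := (q A).hasDegree_toForm x
      rcases h with h | h
      · exact (hd.contract (M.normal A e)).eq_zero (Or.inl (by omega))
      · change contractL _ _ = 0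
        rw [hd.eq_zero (Or.inr (by omega)), map_zero]
    simp [h1, h2]

end Flux

end HodgeLDG

namespace HodgeLDG

/-! ### The semidiscrete evolution equation -/

section Generator

variable {n : ℕ} (M : PolyhedralMesh n) (r k : ℕ)

/-- Extension by zero of families indexed by the cells. -/
noncomputable def extendCells {V : Type*} [AddCommGroup V] [Module ℝ V] : (M.cells → V) →ₗ[ℝ] (Set (E n) → V) := by
  classical
  exact
  { toFun := fun w K => if h : K ∈ M.cells then w ⟨K, h⟩ else 0
    map_add' := fun v w => by
      funext K
      by_cases h : K ∈ M.cells <;> simp [h]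
    map_smul' := fun a w => by
      funext K
      by_cases h : K ∈ M.cells <;> simp [h] }

/-- The unknowns `(σ, u, ρ, p)` on all cells. -/
abbrev State : Type :=
  M.cells → PolyForm n r ((k : ℤ) - 1) × PolyForm n r (k : ℤ) × PolyForm n r ((k : ℤ) + 1) ×
    PolyForm n r (k : ℤ)

variable {M r k}

/-- The component `σ` of a state. -/
noncomputable def stateSigma : State M r k →ₗ[ℝ] Broken n r ((k : ℤ) - 1) :=
  extendCells M ∘ₗ (LinearMap.fst ℝ _ _).compLeft _

/-- The component `u` of a state. -/
noncomputable def stateU : State M r k →ₗ[ℝ] Broken n r (k : ℤ) :=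
  extendCells M ∘ₗ (LinearMap.fst ℝ _ _ ∘ₗ LinearMap.snd ℝ _ _).compLeft _

/-- The component `ρ` of a state. -/
noncomputable def stateRho : State M r k →ₗ[ℝ] Broken n r ((k : ℤ) + 1) :=
  extendCells M ∘ₗ (LinearMap.fst ℝ _ _ ∘ₗ LinearMap.snd ℝ _ _ ∘ₗ LinearMap.snd ℝ _ _).compLeft _

/-- The component `p` of a state. -/
noncomputable def stateP : State M r k →ₗ[ℝ] Broken n r (k : ℤ) :=
  extendCells M ∘ₗ (LinearMap.snd ℝ _ _ ∘ₗ LinearMap.snd ℝ _ _ ∘ₗ LinearMap.snd ℝ _ _).compLeft _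

variable {K : Set (E n)}

lemma stateSigma_apply (X : State M r k) (hK : K ∈ M.cells) : stateSigma X K = (X ⟨K, hK⟩).1 :=
  dif_pos hK

lemma stateU_apply (X : State M r k) (hK : K ∈ M.cells) : stateU X K = (X ⟨K, hK⟩).2.1 :=
  dif_pos hK

lemma stateRho_apply (X : State M r k) (hK : K ∈ M.cells) : stateRho X K = (X ⟨K, hK⟩).2.2.1 :=
  dif_pos hK

lemma stateP_apply (X : State M r k) (hK : K ∈ M.cells) : stateP X K = (X ⟨K, hK⟩).2.2.2 :=
  dif_pos hK

section Pairings

variable {V W : Type*} [AddCommGroup V] [Module ℝ V] [AddCommGroup W] [Module ℝ W]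

variable (M) in
/-- The bilinear form `⟨F v, G w⟩_∂K` for linear families `F, G` of continuous traces. -/
noncomputable def bdryPairing (hK : K ∈ M.cells)
    (F : Set (E n) → V →ₗ[ℝ] (E n → Alt n)) (G : Set (E n) → W →ₗ[ℝ] (E n → Alt n))
    (hF : ∀ e v, Continuous (F e v)) (hG : ∀ e w, Continuous (G e w)) : V →ₗ[ℝ] W →ₗ[ℝ] ℝ :=
  ∑ e : M.facets K, pairing (F e) (G e) (hF e) (hG e) (M.isCompact_facet K hK e e.2)
    (M.facet_measure_ne_top hK e.2)

lemma bdryPairing_apply (hK : K ∈ M.cells)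
    (F : Set (E n) → V →ₗ[ℝ] (E n → Alt n)) (G : Set (E n) → W →ₗ[ℝ] (E n → Alt n))
    (hF : ∀ e v, Continuous (F e v)) (hG : ∀ e w, Continuous (G e w)) (v : V) (w : W) :
    bdryPairing M hK F G hF hG v w = M.bdryInner K (fun _ e => F e v) (fun _ e => G e w) := by
  unfold bdryPairing PolyhedralMesh.bdryInner
  rw [← Finset.sum_coe_sort (M.facets K)]
  simp only [LinearMap.sum_apply]
  rfl

end Pairings

variable (c₀ c₁ : Set (E n) → ℝ) (α₀ α₁ : Penalty n)

/-- The numerical trace `σ̂^tan`. -/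
noncomputable def sigmaHat (X : State M r k) : Trace n :=
  fun _ e => flux M c₀ α₀ r ((k : ℤ) - 1) (k : ℤ) e (stateSigma X, stateP X)

/-- The numerical trace `p̂^tan`. -/
noncomputable def pHat (X : State M r k) : Trace n :=
  fun _ e => flux M c₁ α₁ r (k : ℤ) ((k : ℤ) + 1) e (stateP X, stateRho X)

/-- The numerical trace `p̂^nor`. -/
noncomputable def pHatNor (X : State M r k) : Trace n :=
  fun K e => fluxNor M c₀ α₀ r ((k : ℤ) - 1) (k : ℤ) K e (stateSigma X, stateP X)

/-- Once the numerical traces are linear functions of the state, each right-hand side is bilinear in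
state and test form, and Riesz representation on each cell yields the time derivative. The source is
left out. -/
lemma exists_generator : ∃ A : State M r k →ₗ[ℝ] State M r k, ∀ X, ∀ K (hK : K ∈ M.cells),
    (∀ τ : Broken n r ((k : ℤ) - 1), cellInner K (A X ⟨K, hK⟩).1.toForm (τ K).toForm =
      -cellInner K (codiff (stateP X K).toForm) (τ K).toForm -
        M.bdryInner K (α₀.act (sigmaHat c₀ α₀ X - M.tan (stateSigma X))) (M.tan τ)) ∧
    (A X ⟨K, hK⟩).2.1 = stateP X K ∧
    (∀ η : Broken n r ((k : ℤ) + 1), cellInner K (A X ⟨K, hK⟩).2.2.1.toForm (η K).toForm =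
      -cellInner K (stateP X K).toForm (codiff (η K).toForm) -
        M.bdryInner K (pHat c₁ α₁ X) (M.nor η)) ∧
    (∀ v : Broken n r (k : ℤ), cellInner K (A X ⟨K, hK⟩).2.2.2.toForm (v K).toForm =
      cellInner K (stateSigma X K).toForm (codiff (v K).toForm) +
        cellInner K (codiff (stateRho X K).toForm) (v K).toForm +
        M.bdryInner K (sigmaHat c₀ α₀ X) (M.nor v) +
        M.bdryInner K (α₁.act (pHat c₁ α₁ X - M.tan (stateP X))) (M.tan v)) := by
  have hR : ∀ (j : ℤ) (K : M.cells), ∃ R : (PolyForm n r j →ₗ[ℝ] ℝ) →ₗ[ℝ] PolyForm n r j,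
      ∀ φ v, cellInner (K : Set (E n)) (R φ).toForm v.toForm = φ v := fun j K =>
    exists_riesz r j (M.isCompact_cell K K.2) (M.interior_cell_nonempty K.2)
  choose R hR using hR
  let cp : ∀ (K : M.cells) {j : ℤ} (F : State M r k →ₗ[ℝ] (E n → Alt n))
      (G : PolyForm n r j →ₗ[ℝ] (E n → Alt n)) (_ : ∀ v, Continuous (F v))
      (_ : ∀ w, Continuous (G w)), State M r k →ₗ[ℝ] PolyForm n r j →ₗ[ℝ] ℝ :=
    fun K _ F G hF hG => pairing F G hF hG (μ := volume) (M.isCompact_cell K K.2)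
      (M.isCompact_cell K K.2).measure_ne_top
  have hj0 : (k : ℤ) = (k : ℤ) - 1 + 1 := by ring
  let sH : Set (E n) → State M r k →ₗ[ℝ] (E n → Alt n) := fun e =>
    flux M c₀ α₀ r ((k : ℤ) - 1) (k : ℤ) e ∘ₗ stateSigma.prod stateP
  let pH : Set (E n) → State M r k →ₗ[ℝ] (E n → Alt n) := fun e =>
    flux M c₁ α₁ r (k : ℤ) ((k : ℤ) + 1) e ∘ₗ stateP.prod stateRho
  have hsH : ∀ e X, Continuous (sH e X) := fun e X =>
    continuous_of_mem_range (flux_mem_range hj0 e _)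
  have hpH : ∀ e X, Continuous (pH e X) := fun e X =>
    continuous_of_mem_range (flux_mem_range rfl e _)
  let tS : Set (E n) → Set (E n) → State M r k →ₗ[ℝ] (E n → Alt n) := fun K e =>
    formMap r _ (tanTrL (M.normal K e)) ∘ₗ LinearMap.proj K ∘ₗ stateSigma
  let tP : Set (E n) → Set (E n) → State M r k →ₗ[ℝ] (E n → Alt n) := fun K e =>
    formMap r _ (tanTrL (M.normal K e)) ∘ₗ LinearMap.proj K ∘ₗ stateP
  let Φσ : M.cells → State M r k →ₗ[ℝ] PolyForm n r ((k : ℤ) - 1) →ₗ[ℝ] ℝ := fun K =>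
    -cp K (PolyForm.codiffL ∘ₗ LinearMap.proj (K : Set (E n)) ∘ₗ stateP) PolyForm.toFormL
      (fun _ => PolyForm.continuous_codiff _) PolyForm.continuous_toForm -
    bdryPairing M K.2 (fun e => α₀ K e • (sH e - tS K e))
      (fun e => formMap r _ (tanTrL (M.normal K e)))
      (fun e X => ((hsH e X).sub (continuous_formMap _ _)).const_smul (α₀ K e))
      (fun e w => continuous_formMap _ _)
  let Φρ : M.cells → State M r k →ₗ[ℝ] PolyForm n r ((k : ℤ) + 1) →ₗ[ℝ] ℝ := fun K =>
    -cp K (PolyForm.toFormL ∘ₗ LinearMap.proj (K : Set (E n)) ∘ₗ stateP) PolyForm.codiffL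
      (fun _ => PolyForm.continuous_toForm _) PolyForm.continuous_codiff -
    bdryPairing M K.2 pH (fun e => formMap r _ (contractL (M.normal K e))) hpH
      (fun e w => continuous_formMap _ _)
  let Φp : M.cells → State M r k →ₗ[ℝ] PolyForm n r (k : ℤ) →ₗ[ℝ] ℝ := fun K =>
    cp K (PolyForm.toFormL ∘ₗ LinearMap.proj (K : Set (E n)) ∘ₗ stateSigma) PolyForm.codiffL
      (fun _ => PolyForm.continuous_toForm _) PolyForm.continuous_codiff +
    cp K (PolyForm.codiffL ∘ₗ LinearMap.proj (K : Set (E n)) ∘ₗ stateRho) PolyForm.toFormL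
      (fun _ => PolyForm.continuous_codiff _) PolyForm.continuous_toForm +
    bdryPairing M K.2 sH (fun e => formMap r _ (contractL (M.normal K e))) hsH
      (fun e w => continuous_formMap _ _) +
    bdryPairing M K.2 (fun e => α₁ K e • (pH e - tP K e))
      (fun e => formMap r _ (tanTrL (M.normal K e)))
      (fun e X => ((hpH e X).sub (continuous_formMap _ _)).const_smul (α₁ K e))
      (fun e w => continuous_formMap _ _)
  refine ⟨LinearMap.pi fun K => (R _ K ∘ₗ Φσ K).prod
    ((LinearMap.proj (K : Set (E n)) ∘ₗ stateP).prod ((R _ K ∘ₗ Φρ K).prod (R _ K ∘ₗ Φp K))),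
    fun X K hK => ⟨fun τ => ?_, rfl, fun η => ?_, fun v => ?_⟩⟩
  · refine (hR _ ⟨K, hK⟩ (Φσ ⟨K, hK⟩ X) (τ K)).trans ?_
    simp only [Φσ, LinearMap.sub_apply, LinearMap.neg_apply, bdryPairing_apply]
    rfl
  · refine (hR _ ⟨K, hK⟩ (Φρ ⟨K, hK⟩ X) (η K)).trans ?_
    simp only [Φρ, LinearMap.sub_apply, LinearMap.neg_apply, bdryPairing_apply]
    rfl
  · refine (hR _ ⟨K, hK⟩ (Φp ⟨K, hK⟩ X) (v K)).trans ?_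
    simp only [Φp, LinearMap.add_apply, bdryPairing_apply]
    rfl

end Generator

end HodgeLDG

namespace HodgeLDG

/-! ### Reduction of the method to an ordinary differential equation. -/

section Evolution

lemma contract_add {n : ℕ} (ν : E n) (a b : Alt n) :
    contract ν (a + b) = contract ν a + contract ν b := (contractL ν).map_add a b

lemma hasDerivWithinAt_linearMap_comp {V W : Type*} [NormedAddCommGroup V] [NormedSpace ℝ V]
    [FiniteDimensional ℝ V] [NormedAddCommGroup W] [NormedSpace ℝ W] (L : V →ₗ[ℝ] W) {y : ℝ → V}
    {y' : V} {J : Set ℝ} {t : ℝ} (h : HasDerivWithinAt y y' J t) :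
    HasDerivWithinAt (fun s => L (y s)) (L y') J t :=
  (LinearMap.toContinuousLinearMap L).hasFDerivAt.comp_hasDerivWithinAt t h

variable {n : ℕ} {M : PolyhedralMesh n} {r k : ℕ} {S : Type*} [NormedAddCommGroup S]
  [NormedSpace ℝ S]

namespace PolyhedralMesh

lemma IsVhat.add {j : ℤ} {a b : Trace n} (ha : M.IsVhat r j a) (hb : M.IsVhat r j b) :
    M.IsVhat r j (a + b) := by
  refine ⟨fun K hK e he => ?_, fun K hK L hL e he he' x hx => ?_⟩
  · obtain ⟨p, hp⟩ := ha.1 K hK e he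
    obtain ⟨q, hq⟩ := hb.1 K hK e he
    refine ⟨p + q, fun x hx => ⟨?_, ?_⟩⟩
    · simp [PolyForm.toForm_add, (hp x hx).1, (hq x hx).1]
    · simp [contract_add, (hp x hx).2, (hq x hx).2]
  · simp [ha.2 K hK L hL e he he' x hx, hb.2 K hK L hL e he he' x hx]

lemma IsL2Trace.add {j : ℤ} {a b : Trace n} (ha : M.IsL2Trace j a) (hb : M.IsL2Trace j b) :
    M.IsL2Trace j (a + b) := by
  intro K hK e he
  refine ⟨(ha K hK e he).1.add (hb K hK e he).1, fun x hx => ⟨?_, ?_⟩⟩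
  · exact ((ha K hK e he).2 x hx).1.add ((hb K hK e he).2 x hx).1
  · simp [contract_add, ((ha K hK e he).2 x hx).2, ((hb K hK e he).2 x hx).2]

lemma IsSingleValuedNor.add {a b : Trace n} (ha : M.IsSingleValuedNor a)
    (hb : M.IsSingleValuedNor b) : M.IsSingleValuedNor (a + b) := by
  intro K hK L hL hKL e he he' x hx
  have h1 := ha K hK L hL hKL e he he' x hx
  have h2 := hb K hK L hL hKL e he he' x hx
  simp only [Pi.add_apply]
  rw [add_add_add_comm, h1, h2, add_zero]

end PolyhedralMesh

/-- The fields of the method for the state `(Y t).1` with time integral `(Y t).2`, where states are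
parametrized by a normed space `S`. -/
noncomputable def evolutionFields (Θ : S ≃ₗ[ℝ] State M r k) (c₀ c₁ : Set (E n) → ℝ) (α₀ α₁ : Penalty n)
    (Y : ℝ → S × S) (a b : Trace n) : Fields n r k where
  σ t := stateSigma (Θ (Y t).1)
  u t := stateU (Θ (Y t).1)
  ρ t := stateRho (Θ (Y t).1)
  p t := stateP (Θ (Y t).1)
  sigmahatTan t := sigmaHat c₀ α₀ (Θ (Y t).1)
  phatTan t := pHat c₁ α₁ (Θ (Y t).1)
  uhatTan t := a + pHat c₁ α₁ (Θ (Y t).2)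
  uhatNor t := b + pHatNor c₀ α₀ (Θ (Y t).2)

lemma uniqueDiffOn_of_ordConnected {J : Set ℝ} (hJ : J.OrdConnected) (hJ' : J.Nontrivial) :
    UniqueDiffOn ℝ J :=
  uniqueDiffOn_convex hJ.convex (hJ.convex.nontrivial_iff_nonempty_interior.1 hJ')

/-- The weak form of the equations for the time derivative `X'` of a state `X`, with right-hand side
`g` in the equation for `ṗ`. -/
structure IsRate (c₀ c₁ : Set (E n) → ℝ) (α₀ α₁ : Penalty n) (X X' : State M r k)
    (g : (K : Set (E n)) → Lp (Alt n) 2 ((volume : Measure (E n)).restrict K)) : Prop where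
  eq_sigma : ∀ K ∈ M.cells, ∀ τ : Broken n r ((k : ℤ) - 1),
    cellInner K (stateSigma X' K).toForm (τ K).toForm =
      -cellInner K (codiff (stateP X K).toForm) (τ K).toForm -
        M.bdryInner K (α₀.act (sigmaHat c₀ α₀ X - M.tan (stateSigma X))) (M.tan τ)
  eq_u : ∀ K ∈ M.cells, stateU X' K = stateP X K
  eq_rho : ∀ K ∈ M.cells, ∀ η : Broken n r ((k : ℤ) + 1),
    cellInner K (stateRho X' K).toForm (η K).toForm =
      -cellInner K (stateP X K).toForm (codiff (η K).toForm) -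
        M.bdryInner K (pHat c₁ α₁ X) (M.nor η)
  eq_p : ∀ K ∈ M.cells, ∀ v : Broken n r (k : ℤ),
    cellInner K (stateP X' K).toForm (v K).toForm =
      cellInner K (stateSigma X K).toForm (codiff (v K).toForm) +
        cellInner K (codiff (stateRho X K).toForm) (v K).toForm +
        M.bdryInner K (sigmaHat c₀ α₀ X) (M.nor v) +
        M.bdryInner K (α₁.act (pHat c₁ α₁ X - M.tan (stateP X))) (M.tan v) -
        cellInner K (g K) (v K).toForm

-- The source affects only the p-component, where it enters through its L² projection onto
-- polynomial forms.
variable (r k) in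
lemma exists_rate (c₀ c₁ : Set (E n) → ℝ) (α₀ α₁ : Penalty n) :
    ∃ (A : State M r k →ₗ[ℝ] State M r k)
      (P : ∀ K : M.cells, Lp (Alt n) 2 ((volume : Measure (E n)).restrict K) →L[ℝ]
        PolyForm n r (k : ℤ)),
      ∀ X g, IsRate c₀ c₁ α₀ α₁ X (fun K => A X K - (0, 0, 0, P K (g K))) g := by
  obtain ⟨A₀, hA₀⟩ := exists_generator (M := M) (r := r) (k := k) c₀ c₁ α₀ α₁
  have hP : ∀ K : M.cells, ∃ P : Lp (Alt n) 2 ((volume : Measure (E n)).restrict K) →L[ℝ]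
      PolyForm n r (k : ℤ), ∀ h, ∀ v : PolyForm n r (k : ℤ),
        cellInner (K : Set (E n)) (P h).toForm v.toForm = cellInner K h v.toForm := fun K =>
    exists_projection r k (M.isCompact_cell K K.2) (M.interior_cell_nonempty K.2)
  choose P hP using hP
  refine ⟨A₀, P, fun X g => ⟨fun K hK τ => ?_, fun K hK => ?_, fun K hK η => ?_, fun K hK v => ?_⟩⟩
  · rw [stateSigma_apply _ hK, ← (hA₀ X K hK).1 τ, Prod.fst_sub, sub_zero]
  · rw [stateU_apply _ hK, ← (hA₀ X K hK).2.1, Prod.snd_sub, Prod.fst_sub, sub_zero]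
  · rw [stateRho_apply _ hK, ← (hA₀ X K hK).2.2.1 η, Prod.snd_sub, Prod.snd_sub, Prod.fst_sub,
      sub_zero]
  · rw [stateP_apply _ hK, ← (hA₀ X K hK).2.2.2 v, Prod.snd_sub, Prod.snd_sub, Prod.snd_sub,
      ← hP ⟨K, hK⟩]
    simp only [← cellForm_apply (M.isCompact_cell K hK), map_sub, LinearMap.sub_apply]

/-- The second factor of `S × S` records the time integral of the state. As p̂^tan and p̂^nor are
linear in the state, û is its initial value plus the same linear map applied to this integral.
Keeping the source term apart, behind `B`, lets one field serve both the method and its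
linearization. -/
lemma exists_evolution_field [FiniteDimensional ℝ S] (Θ : S ≃ₗ[ℝ] State M r k)
    (c₀ c₁ : Set (E n) → ℝ) (α₀ α₁ : Penalty n) :
    ∃ (A : S × S →L[ℝ] S × S)
      (B : ∀ K : M.cells, Lp (Alt n) 2 ((volume : Measure (E n)).restrict K) →L[ℝ] S × S),
      ∀ y g, ∃ X' : State M r k, A y - ∑ K, B K (g K) = (Θ.symm X', y.1) ∧
        IsRate c₀ c₁ α₀ α₁ (Θ y.1) X' g := by
  obtain ⟨A₀, P, hP⟩ := exists_rate (M := M) r k c₀ c₁ α₀ α₁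
  classical
  let ι : ∀ K : M.cells, PolyForm n r (k : ℤ) →ₗ[ℝ] State M r k := fun K =>
    LinearMap.single ℝ _ K ∘ₗ LinearMap.inr ℝ _ _ ∘ₗ LinearMap.inr ℝ _ _ ∘ₗ LinearMap.inr ℝ _ _
  let A₁ : S →ₗ[ℝ] S := Θ.symm.toLinearMap ∘ₗ A₀ ∘ₗ Θ.toLinearMap
  let ι₁ : ∀ K : M.cells, PolyForm n r (k : ℤ) →ₗ[ℝ] S := fun K => Θ.symm.toLinearMap ∘ₗ ι K
  let A₂ : S →L[ℝ] S := A₁.toContinuousLinearMap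
  let ι₂ : ∀ K : M.cells, PolyForm n r (k : ℤ) →L[ℝ] S := fun K => (ι₁ K).toContinuousLinearMap
  refine ⟨(A₂ ∘L ContinuousLinearMap.fst ℝ S S).prod (ContinuousLinearMap.fst ℝ S S),
    fun K => ContinuousLinearMap.inl ℝ S S ∘L ι₂ K ∘L P K, fun y g => ⟨_, ?_, hP _ _⟩⟩
  have h1 : (fun K => A₀ (Θ y.1) K - (0, 0, 0, P K (g K)) : State M r k) =
      A₀ (Θ y.1) - ∑ K, ι K (P K (g K)) := by
    funext K
    rw [Pi.sub_apply, Finset.sum_apply, Finset.sum_eq_single K]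
    · congr 1
      exact (Pi.single_eq_same (M := fun _ : M.cells => PolyForm n r ((k : ℤ) - 1) ×
        PolyForm n r (k : ℤ) × PolyForm n r ((k : ℤ) + 1) × PolyForm n r (k : ℤ)) K _).symm
    · intro L _ hL
      exact Pi.single_eq_of_ne (M := fun _ : M.cells => PolyForm n r ((k : ℤ) - 1) ×
        PolyForm n r (k : ℤ) × PolyForm n r ((k : ℤ) + 1) × PolyForm n r (k : ℤ)) hL.symm _
    · exact fun h => absurd (Finset.mem_univ K) h
  rw [h1, map_sub, map_sum]
  refine Prod.ext ?_ ?_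
  · rw [Prod.fst_sub, Prod.fst_sum]
    rfl
  · rw [Prod.snd_sub, Prod.snd_sum]
    exact (congrArg (y.1 - ·) Finset.sum_const_zero).trans (sub_zero _)

end Evolution

end HodgeLDG

namespace HodgeLDG

/-! ### From trajectories of the differential equation to solutions of the method. -/

section Solves

variable {n : ℕ} {M : PolyhedralMesh n} {r k : ℕ} {S : Type*} [NormedAddCommGroup S]
  [NormedSpace ℝ S]

lemma phatNor_evolutionFields (Θ : S ≃ₗ[ℝ] State M r k) (c₀ c₁ : Set (E n) → ℝ) (α₀ α₁ : Penalty n)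
    (Y : ℝ → S × S) (a b : Trace n) (t : ℝ) :
    (evolutionFields Θ c₀ c₁ α₀ α₁ Y a b).phatNor M α₀ t = fun K e => fluxNor M c₀ α₀ r
      ((k : ℤ) - 1) (k : ℤ) K e (stateSigma (Θ (Y t).1), stateP (Θ (Y t).1)) := by
  funext K e x
  exact (fluxNor_apply M c₀ α₀ K e _ _ x).symm

lemma rhohatNor_evolutionFields (Θ : S ≃ₗ[ℝ] State M r k) (c₀ c₁ : Set (E n) → ℝ) (α₀ α₁ : Penalty n)
    (Y : ℝ → S × S) (a b : Trace n) (t : ℝ) :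
    (evolutionFields Θ c₀ c₁ α₀ α₁ Y a b).rhohatNor M α₁ t = fun K e => fluxNor M c₁ α₁ r
      (k : ℤ) ((k : ℤ) + 1) K e (stateP (Θ (Y t).1), stateRho (Θ (Y t).1)) := by
  funext K e x
  exact (fluxNor_apply M c₁ α₁ K e _ _ x).symm

variable [FiniteDimensional ℝ S]

/-- The cellwise equations sum to the weak ones, and the flux weights give conservativity through
`skelInner_eq_zero`. With u = 0 at t₀ the initial constraints reduce to `hσ` and `hρ`. -/
lemma solvesMethod_evolutionFields (Θ : S ≃ₗ[ℝ] State M r k) {c₀ c₁ : Set (E n) → ℝ}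
    {α₀ α₁ : Penalty n} (hc₀ : IsFluxWeight M c₀ α₀ ((k : ℤ) - 1))
    (hc₁ : IsFluxWeight M c₁ α₁ (k : ℤ))
    {g : ℝ → (K : Set (E n)) → Lp (Alt n) 2 ((volume : Measure (E n)).restrict K)}
    {J : Set ℝ} (hJ : J.OrdConnected) (hJ' : J.Nontrivial) {t₀ : ℝ}
    {Y : ℝ → S × S} {a b : Trace n} {X' : ℝ → State M r k}
    (hY : ∀ t ∈ J, HasDerivWithinAt Y (Θ.symm (X' t), (Y t).1) J t)
    (hX' : ∀ t ∈ J, IsRate c₀ c₁ α₀ α₁ (Θ (Y t).1) (X' t) (g t))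
    (hY2 : (Y t₀).2 = 0) (hU : stateU (Θ (Y t₀).1) = 0)
    (ha : M.IsVhat r (k : ℤ) a) (hb : M.IsL2Trace ((k : ℤ) - 1) b) (hb' : M.IsSingleValuedNor b)
    (hσ : ∀ K ∈ M.cells, ∀ τ : Broken n r ((k : ℤ) - 1), M.bdryInner K b (M.tan τ) =
      cellInner K (stateSigma (Θ (Y t₀).1) K).toForm (τ K).toForm)
    (hρ : ∀ K ∈ M.cells, ∀ η : Broken n r ((k : ℤ) + 1), M.bdryInner K a (M.nor η) =
      -cellInner K (stateRho (Θ (Y t₀).1) K).toForm (η K).toForm) :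
    SolvesMethod M α₀ α₁ g J t₀ (evolutionFields Θ c₀ c₁ α₀ α₁ Y a b) := by
  have hj0 : (k : ℤ) = (k : ℤ) - 1 + 1 := by ring
  have hud := uniqueDiffOn_of_ordConnected hJ hJ'
  have hcomp : ∀ {V : Type} [NormedAddCommGroup V] [NormedSpace ℝ V] (L : State M r k →ₗ[ℝ] V),
      ∀ t ∈ J, HasDerivWithinAt (fun s => L (Θ (Y s).1)) (L (X' t)) J t := by
    intro V _ _ L t ht
    have h := hasDerivWithinAt_linearMap_comp (L ∘ₗ Θ.toLinearMap ∘ₗ LinearMap.fst ℝ S S) (hY t ht)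
    have h2 : (L ∘ₗ Θ.toLinearMap ∘ₗ LinearMap.fst ℝ S S) (Θ.symm (X' t), (Y t).1) = L (X' t) :=
      congrArg L (Θ.apply_symm_apply _)
    rw [h2] at h
    exact h
  have hcomp' : ∀ {V : Type} [NormedAddCommGroup V] [NormedSpace ℝ V] (L : State M r k →ₗ[ℝ] V),
      ∀ t ∈ J, HasDerivWithinAt (fun s => L (Θ (Y s).2)) (L (Θ (Y t).1)) J t := fun L t ht =>
    hasDerivWithinAt_linearMap_comp (L ∘ₗ Θ.toLinearMap ∘ₗ LinearMap.snd ℝ S S) (hY t ht)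
  have hdσ : ∀ t ∈ J, ∀ K, HasDerivWithinAt (fun s => stateSigma (Θ (Y s).1) K)
      (stateSigma (X' t) K) J t := fun t ht K => hcomp (LinearMap.proj K ∘ₗ stateSigma) t ht
  have hdu : ∀ t ∈ J, ∀ K, HasDerivWithinAt (fun s => stateU (Θ (Y s).1) K)
      (stateU (X' t) K) J t := fun t ht K => hcomp (LinearMap.proj K ∘ₗ stateU) t ht
  have hdρ : ∀ t ∈ J, ∀ K, HasDerivWithinAt (fun s => stateRho (Θ (Y s).1) K)
      (stateRho (X' t) K) J t := fun t ht K => hcomp (LinearMap.proj K ∘ₗ stateRho) t ht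
  have hdp : ∀ t ∈ J, ∀ K, HasDerivWithinAt (fun s => stateP (Θ (Y s).1) K)
      (stateP (X' t) K) J t := fun t ht K => hcomp (LinearMap.proj K ∘ₗ stateP) t ht
  refine
    { diff_σ := fun K _ t ht => (hdσ t ht K).differentiableWithinAt
      diff_u := fun K _ t ht => (hdu t ht K).differentiableWithinAt
      diff_ρ := fun K _ t ht => (hdρ t ht K).differentiableWithinAt
      diff_p := fun K _ t ht => (hdp t ht K).differentiableWithinAt
      mem_sigmahatTan := fun t _ => isVhat_flux hj0 _
      mem_phatTan := fun t _ => isVhat_flux rfl _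
      mem_uhatTan := fun t _ => ha.add (isVhat_flux rfl _)
      mem_uhatNor := fun t _ => hb.add (isL2Trace_fluxNor hj0 _)
      single_uhatNor := fun t _ => hb'.add (isSingleValuedNor_fluxNor hj0 hc₀ _)
      eq_σ := ?_
      eq_u := ?_
      eq_ρ := ?_
      eq_p := ?_
      cons_p := fun t _ w hw => by
        rw [phatNor_evolutionFields]
        exact M.skelInner_eq_zero (isSingleValuedNor_fluxNor hj0 hc₀ _) hw
      cons_ρ := fun t _ w hw => by
        rw [rhohatNor_evolutionFields]
        exact M.skelInner_eq_zero (isSingleValuedNor_fluxNor rfl hc₁ _) hw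
      deriv_uhatTan := ?_
      deriv_uhatNor := ?_
      init_σ := ?_
      init_ρ := ?_ }
  · intro t ht τ
    unfold PolyhedralMesh.skelInner
    rw [← Finset.sum_add_distrib, ← Finset.sum_add_distrib]
    refine Finset.sum_eq_zero fun K hK => ?_
    have h1 : timeDeriv J (fun s => stateSigma (Θ (Y s).1)) t K = stateSigma (X' t) K :=
      (hdσ t ht K).derivWithin (hud t ht)
    simp only [evolutionFields]
    rw [h1, (hX' t ht).eq_sigma K hK τ]
    ring
  · intro t ht s
    refine Finset.sum_congr rfl fun K hK => ?_
    have h1 : timeDeriv J (fun s => stateU (Θ (Y s).1)) t K = stateU (X' t) K :=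
      (hdu t ht K).derivWithin (hud t ht)
    simp only [evolutionFields]
    rw [h1, (hX' t ht).eq_u K hK]
  · intro t ht η
    unfold PolyhedralMesh.skelInner
    rw [← Finset.sum_add_distrib, ← Finset.sum_add_distrib]
    refine Finset.sum_eq_zero fun K hK => ?_
    have h1 : timeDeriv J (fun s => stateRho (Θ (Y s).1)) t K = stateRho (X' t) K :=
      (hdρ t ht K).derivWithin (hud t ht)
    simp only [evolutionFields]
    rw [h1, (hX' t ht).eq_rho K hK η]
    ring
  · intro t ht v
    unfold PolyhedralMesh.skelInner
    rw [← Finset.sum_neg_distrib, ← Finset.sum_add_distrib, ← Finset.sum_add_distrib,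
      ← Finset.sum_add_distrib, ← Finset.sum_add_distrib]
    refine Finset.sum_congr rfl fun K hK => ?_
    have h1 : timeDeriv J (fun s => stateP (Θ (Y s).1)) t K = stateP (X' t) K :=
      (hdp t ht K).derivWithin (hud t ht)
    simp only [evolutionFields]
    rw [h1, (hX' t ht).eq_p K hK v]
    ring
  · intro t ht K _ e _ x _
    exact (hcomp' (LinearMap.proj x ∘ₗ flux M c₁ α₁ r (k : ℤ) ((k : ℤ) + 1) e ∘ₗ
      stateP.prod stateRho) t ht).const_add (a K e x)
  · intro t ht K _ e _ x _
    rw [phatNor_evolutionFields]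
    exact (hcomp' (LinearMap.proj x ∘ₗ fluxNor M c₀ α₀ r ((k : ℤ) - 1) (k : ℤ) K e ∘ₗ
      stateSigma.prod stateP) t ht).const_add (b K e x)
  · intro τ
    -- The time integral starts from zero, so û^nor equals `b` at t₀.
    have h1 : pHatNor c₀ α₀ (Θ (Y t₀).2) = (0 : Trace n) := by
      funext K e
      simp only [hY2, pHatNor, map_zero, ← Prod.zero_eq_mk, Pi.zero_apply]
    simp only [evolutionFields, hU, h1, add_zero, Pi.zero_apply, PolyForm.toForm_zero,
      cellInner_zero_left, Finset.sum_const_zero, zero_sub, PolyhedralMesh.skelInner]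
    rw [Finset.sum_congr rfl fun K hK => hσ K hK τ]
  · intro η
    have h1 : pHat c₁ α₁ (Θ (Y t₀).2) = (0 : Trace n) := by
      funext K e
      simp only [hY2, pHat, map_zero, ← Prod.zero_eq_mk, Pi.zero_apply]
    simp only [evolutionFields, hU, h1, add_zero, Pi.zero_apply, PolyForm.toForm_zero,
      cellInner_zero_left, Finset.sum_const_zero, zero_add, PolyhedralMesh.skelInner]
    rw [Finset.sum_congr rfl fun K hK => hρ K hK η, Finset.sum_neg_distrib]

end Solves

end HodgeLDG

namespace HodgeLDG

/-! ### Local solutions, and first variations with prescribed initial data. -/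

section Existence

open scoped NNReal

variable {n : ℕ} {M : PolyhedralMesh n} {r k : ℕ}

variable (M r k) in
lemma exists_parametrization : ∃ d : ℕ, Nonempty ((Fin d → ℝ) ≃ₗ[ℝ] State M r k) :=
  ⟨_, ⟨(Module.finBasis ℝ (State M r k)).equivFun.symm⟩⟩

variable {S : Type*} [NormedAddCommGroup S] [NormedSpace ℝ S] [FiniteDimensional ℝ S]

/-- The component `u` on the cell `K`, as a continuous linear map. -/
noncomputable def stateUCLM (Θ : S ≃ₗ[ℝ] State M r k) (K : Set (E n)) :
    S × S →L[ℝ] PolyForm n r (k : ℤ) :=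
  (LinearMap.proj K ∘ₗ stateU ∘ₗ Θ.toLinearMap ∘ₗ LinearMap.fst ℝ S S).toContinuousLinearMap

/-- Mean value inequality, with the derivative bounded on the compact set [a, b] × ball. -/
lemma Source.IsAdmissible.exists_lipschitz {I : Set ℝ} {f : Source n r k}
    (hf : f.IsAdmissible M I) {K : Set (E n)} (hK : K ∈ M.cells) {a b : ℝ} (hab : Icc a b ⊆ I)
    (R : ℝ) : ∃ C : ℝ≥0, ∀ t ∈ Icc a b, LipschitzOnWith C (f K t) (Metric.closedBall 0 R) := by
  have hc : IsCompact (Icc a b ×ˢ Metric.closedBall (0 : PolyForm n r (k : ℤ)) R) :=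
    isCompact_Icc.prod (isCompact_closedBall _ _)
  obtain ⟨C, hC⟩ := hc.exists_bound_of_continuousOn
    ((hf.continuousOn_fderiv K hK).mono (prod_mono hab (subset_univ _)))
  refine ⟨C.toNNReal, fun t ht => ?_⟩
  refine (convex_closedBall _ _).lipschitzOnWith_of_nnnorm_fderiv_le (𝕜 := ℝ)
    (fun x _ => hf.differentiable K hK t (hab ht) x) fun x hx => ?_
  rw [← NNReal.coe_le_coe, coe_nnnorm]
  exact (hC (t, x) ⟨ht, hx⟩).trans (Real.le_coe_toNNReal _)

/-- Zero initial data satisfy the initial constraints, so the equation is solved from 0; a Lipschitz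
bound on the unit ball around 0 is enough. -/
theorem exists_solution (Θ : S ≃ₗ[ℝ] State M r k) {c₀ c₁ : Set (E n) → ℝ} {α₀ α₁ : Penalty n}
    (hc₀ : IsFluxWeight M c₀ α₀ ((k : ℤ) - 1)) (hc₁ : IsFluxWeight M c₁ α₁ (k : ℤ))
    {I : Set ℝ} (hI : I.OrdConnected) (hI' : I.Nontrivial) {f : Source n r k}
    (hf : f.IsAdmissible M I) {t₀ : ℝ} (ht₀ : t₀ ∈ I) :
    ∃ J ⊆ I, J.OrdConnected ∧ J ∈ 𝓝[I] t₀ ∧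
      ∃ z : Fields n r k, IsSolution M α₀ α₁ f J t₀ z := by
  obtain ⟨A, B, hAB⟩ := exists_evolution_field Θ c₀ c₁ α₀ α₁
  have : CompleteSpace (S × S) := FiniteDimensional.complete ℝ _
  let F : ℝ → S × S → S × S := fun t y => A y - ∑ K, B K (f K t (stateUCLM Θ K y))
  have hF : ContinuousOn (fun q : ℝ × (S × S) => F q.1 q.2) (I ×ˢ univ) := by
    refine (A.continuous.comp continuous_snd).continuousOn.sub
      (continuousOn_finsetSum _ fun K _ => (B K).continuous.comp_continuousOn ?_)
    exact (hf.continuousOn K K.2).comp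
      (f := fun q : ℝ × (S × S) => (q.1, stateUCLM Θ (K : Set (E n)) q.2))
      (by fun_prop) (fun q hq => ⟨hq.1, mem_univ _⟩)
  obtain ⟨J, hJI, hJ, hJ', hJn, ht₀J, Y, hY0, hY⟩ := exists_local_ode hI hI' ht₀ hF 0 (by
    intro a b hab
    have hL := fun K : M.cells => hf.exists_lipschitz K.2 hab ‖stateUCLM Θ (K : Set (E n))‖
    choose C hC using hL
    refine ⟨‖A‖₊ + ∑ K : M.cells, ‖B K‖₊ * (C K * ‖stateUCLM Θ (K : Set (E n))‖₊), fun t ht => ?_⟩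
    refine LipschitzOnWith.of_dist_le_mul fun x hx y hy => ?_
    rw [dist_eq_norm, dist_eq_norm]
    have hmem : ∀ (K : Set (E n)), ∀ x ∈ Metric.closedBall (0 : S × S) 1,
        stateUCLM Θ K x ∈ Metric.closedBall 0 ‖stateUCLM Θ K‖ := by
      intro K x hx
      rw [mem_closedBall_zero_iff] at hx ⊢
      exact (ContinuousLinearMap.le_opNorm _ _).trans
        (mul_le_of_le_one_right (norm_nonneg _) hx)
    have h1 : F t x - F t y = A (x - y) -
        ∑ K, B K (f K t (stateUCLM Θ K x) - f K t (stateUCLM Θ K y)) := by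
      simp only [F, map_sub, Finset.sum_sub_distrib]
      abel
    rw [h1]
    refine (norm_sub_le _ _).trans ?_
    push_cast
    rw [add_mul, Finset.sum_mul]
    refine add_le_add (A.le_opNorm _) ((norm_sum_le _ _).trans (Finset.sum_le_sum fun K _ => ?_))
    refine ((B K).le_opNorm _).trans ?_
    rw [mul_assoc]
    refine mul_le_mul_of_nonneg_left ?_ (norm_nonneg _)
    have h2 := (hC K t ht).dist_le_mul _ (hmem K x hx) _ (hmem K y hy)
    rw [dist_eq_norm, dist_eq_norm, ← map_sub] at h2
    refine h2.trans ?_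
    rw [mul_assoc]
    exact mul_le_mul_of_nonneg_left (ContinuousLinearMap.le_opNorm _ _) (C K).2)
  refine ⟨J, hJI, hJ, hJn, evolutionFields Θ c₀ c₁ α₀ α₁ Y 0 0, ?_⟩
  choose X' hX1 hX2 using fun t => hAB (Y t) (fun K => f K t (stateU (Θ (Y t).1) K))
  refine solvesMethod_evolutionFields Θ hc₀ hc₁ hJ hJ' (X' := X') (fun t ht => ?_)
    (fun t _ => hX2 t) ?_ ?_ ?_ ?_ ?_ ?_ ?_
  · rw [← hX1 t]
    exact hY t ht
  · rw [hY0]; rfl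
  · rw [hY0, Prod.fst_zero, map_zero, map_zero]
  · refine ⟨fun K hK e he => ⟨0, fun x _ => ⟨?_, (contractL _).map_zero⟩⟩,
      fun _ _ _ _ _ _ _ _ _ => rfl⟩
    rw [PolyForm.toForm_zero]; rfl
  · exact fun K hK e he => ⟨MemLp.zero, fun x _ => ⟨HasDegree.zero _, (contractL _).map_zero⟩⟩
  · exact fun _ _ _ _ _ _ _ _ _ _ => add_zero _
  · intro K hK τ
    rw [hY0, Prod.fst_zero, map_zero, map_zero, Pi.zero_apply, PolyForm.toForm_zero,
      cellInner_zero_left, M.bdryInner_zero_left]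
  · intro K hK τ
    rw [hY0, Prod.fst_zero, map_zero, map_zero, Pi.zero_apply, PolyForm.toForm_zero,
      cellInner_zero_left, M.bdryInner_zero_left, neg_zero]

/-- Riesz representatives of boundary functionals. -/
lemma exists_boundary_riesz {j : ℤ} {K : Set (E n)} (hK : K ∈ M.cells) (b : Trace n)
    (hb : ∀ e, Continuous (b K e)) (L : Set (E n) → Alt n →ₗ[ℝ] Alt n) :
    ∃ σ : PolyForm n r j, (b = 0 → σ = 0) ∧ ∀ τ : PolyForm n r j,
      M.bdryInner K b (fun _ e x => L e (τ.toForm x)) = cellInner K σ.toForm τ.toForm := by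
  obtain ⟨R, hR⟩ := exists_riesz r j (M.isCompact_cell K hK) (M.interior_cell_nonempty hK)
  let φ := bdryPairing M hK (fun e => LinearMap.toSpanSingleton ℝ (E n → Alt n) (b K e))
    (fun e => formMap r j (L e)) (fun e c => (hb e).const_smul c)
    (fun e w => continuous_formMap _ _) 1
  have hφ : ∀ τ : PolyForm n r j, φ τ = M.bdryInner K b (fun _ e x => L e (τ.toForm x)) := by
    intro τ
    refine (bdryPairing_apply hK _ _ _ _ _ _).trans ?_
    refine M.bdryInner_congr hK (fun e _ x _ => ?_) fun e _ x _ => rfl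
    simp
  refine ⟨R φ, fun h0 => ?_, fun τ => ?_⟩
  · have : φ = 0 := by
      refine LinearMap.ext fun τ => ?_
      rw [hφ, h0, M.bdryInner_zero_left]
      rfl
    rw [this, map_zero]
  · rw [hR, hφ]

/-- The linearization along `z` has continuous coefficients, hence a solution on all of `J`. The
conclusion records what the bracket needs at t₀: û, p, u = 0, the formulas for σ̂^tan and p̂^tan,
and the vanishing of σ and ρ when the corresponding û does. -/
theorem exists_firstVariation (Θ : S ≃ₗ[ℝ] State M r k) {c₀ c₁ : Set (E n) → ℝ}
    {α₀ α₁ : Penalty n} (hc₀ : IsFluxWeight M c₀ α₀ ((k : ℤ) - 1))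
    (hc₁ : IsFluxWeight M c₁ α₁ (k : ℤ)) {I J : Set ℝ} {f : Source n r k}
    (hf : f.IsAdmissible M I) (hJI : J ⊆ I) (hJ : J.OrdConnected) (hJ' : J.Nontrivial) {t₀ : ℝ}
    (ht₀ : t₀ ∈ J) {z : Fields n r k} (hz : ∀ K ∈ M.cells, ContinuousOn (fun t => z.u t K) J)
    (p₀ : Broken n r (k : ℤ)) {a b : Trace n} (ha : M.IsVhat r (k : ℤ) a)
    (ha' : ∀ K e, Continuous (a K e)) (hb : M.IsL2Trace ((k : ℤ) - 1) b)
    (hb' : ∀ K e, Continuous (b K e)) (hb'' : M.IsSingleValuedNor b) :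
    ∃ w : Fields n r k, IsFirstVariation M α₀ α₁ f J t₀ z w ∧
      (∀ K ∈ M.cells, w.u t₀ K = 0) ∧ (∀ K ∈ M.cells, w.p t₀ K = p₀ K) ∧
      w.uhatTan t₀ = a ∧ w.uhatNor t₀ = b ∧
      (w.sigmahatTan t₀ = fun _ e =>
        flux M c₀ α₀ r ((k : ℤ) - 1) (k : ℤ) e (w.σ t₀, w.p t₀)) ∧
      (w.phatTan t₀ = fun _ e => flux M c₁ α₁ r (k : ℤ) ((k : ℤ) + 1) e (w.p t₀, w.ρ t₀)) ∧
      (b = 0 → ∀ K ∈ M.cells, w.σ t₀ K = 0) ∧ (a = 0 → ∀ K ∈ M.cells, w.ρ t₀ K = 0) := by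
  obtain ⟨A, B, hAB⟩ := exists_evolution_field Θ c₀ c₁ α₀ α₁
  have : CompleteSpace (S × S) := FiniteDimensional.complete ℝ _
  let D : ∀ K : M.cells, ℝ → PolyForm n r (k : ℤ) →L[ℝ]
      Lp (Alt n) 2 ((volume : Measure (E n)).restrict K) := fun K t => fderiv ℝ (f K t) (z.u t K)
  have hD : ∀ K, ContinuousOn (D K) J := fun K =>
    (hf.continuousOn_fderiv K K.2).comp (f := fun t => (t, z.u t K))
      (continuousOn_id.prodMk (hz K K.2)) (fun t ht => ⟨hJI ht, mem_univ _⟩)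
  have hσ := fun K : M.cells => exists_boundary_riesz (r := r) (j := (k : ℤ) - 1) K.2 b
    (hb' K) (fun e => tanTrL (M.normal K e))
  choose σ₀ hσ0 hσ using hσ
  have hρ := fun K : M.cells => exists_boundary_riesz (r := r) (j := (k : ℤ) + 1) K.2 a
    (ha' K) (fun e => contractL (M.normal K e))
  choose ρ₀ hρ0 hρ using hρ
  -- The signs come from the constraints at u = 0: ⟨b, τ^tan⟩ = (σ, τ) but ⟨a, η^nor⟩ = -(ρ, η).
  let X₀ : State M r k := fun K => (σ₀ K, 0, -ρ₀ K, p₀ K)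
  obtain ⟨Y, hY0, hY⟩ := exists_linear_ode hJ ht₀
    (A := fun t => A - ∑ K, B K ∘L D K t ∘L stateUCLM Θ K)
    (continuousOn_const.sub (continuousOn_finsetSum _ fun K _ =>
      continuousOn_const.clm_comp ((hD K).clm_comp continuousOn_const))) (Θ.symm X₀, 0)
  choose X' hX1 hX2 using fun t => hAB (Y t)
    (fun K => fderiv ℝ (f K t) (z.u t K) (stateU (Θ (Y t).1) K))
  have hX₀ : Θ (Y t₀).1 = X₀ := by
    rw [hY0]
    exact Θ.apply_symm_apply _
  have hY2 : (Y t₀).2 = 0 := by rw [hY0]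
  have hU : stateU X₀ = 0 := by
    funext K
    by_cases hK : K ∈ M.cells
    · exact stateU_apply X₀ hK
    · exact dif_neg hK
  refine ⟨evolutionFields Θ c₀ c₁ α₀ α₁ Y a b, ?_, fun K hK => ?_, fun K hK => ?_, ?_, ?_, rfl, rfl,
    fun h K hK => ?_, fun h K hK => ?_⟩
  · refine solvesMethod_evolutionFields Θ hc₀ hc₁ hJ hJ' (X' := X') (fun t ht => ?_)
      (fun t _ => hX2 t) hY2 ?_ ha hb hb'' ?_ ?_
    · rw [← hX1 t]
      have h := hY t ht
      simp only [sub_apply, sum_apply] at h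
      exact h
    · rw [hX₀, hU]
    · intro K hK τ
      rw [hX₀, stateSigma_apply _ hK]
      exact hσ ⟨K, hK⟩ (τ K)
    · intro K hK η
      rw [hX₀, stateRho_apply _ hK]
      refine (hρ ⟨K, hK⟩ (η K)).trans ?_
      simp only [X₀, ← cellForm_apply (M.isCompact_cell K hK), map_neg, LinearMap.neg_apply,
        neg_neg]
  · change stateU (Θ (Y t₀).1) K = 0
    rw [hX₀, hU]
    rfl
  · change stateP (Θ (Y t₀).1) K = _
    rw [hX₀, stateP_apply _ hK]
  · funext K e
    change a K e + flux M c₁ α₁ r (k : ℤ) ((k : ℤ) + 1) e _ = _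
    rw [hY2, map_zero, map_zero, map_zero, ← Prod.zero_eq_mk, map_zero, add_zero]
  · funext K e
    change b K e + fluxNor M c₀ α₀ r ((k : ℤ) - 1) (k : ℤ) K e _ = _
    rw [hY2, map_zero, map_zero, map_zero, ← Prod.zero_eq_mk, map_zero, add_zero]
  · change stateSigma (Θ (Y t₀).1) K = 0
    rw [hX₀, stateSigma_apply _ hK]
    exact hσ0 ⟨K, hK⟩ h
  · change stateRho (Θ (Y t₀).1) K = 0
    rw [hX₀, stateRho_apply _ hK]
    exact neg_eq_zero.2 (hρ0 ⟨K, hK⟩ h)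

end Existence

end HodgeLDG

namespace HodgeLDG

/-! ### Failure of the multisymplectic conservation law -/

section Failure

variable {n : ℕ} {M : PolyhedralMesh n} {r k : ℕ}

/-- Testing with a form supported on one cell localizes the summed equation. -/
lemma SolvesMethod.cellInner_timeDeriv_u {α₀ α₁ : Penalty n}
    {g : ℝ → (K : Set (E n)) → Lp (Alt n) 2 ((volume : Measure (E n)).restrict K)} {J : Set ℝ}
    {t₀ : ℝ} {z : Fields n r k} (hz : SolvesMethod M α₀ α₁ g J t₀ z) {t : ℝ} (ht : t ∈ J)
    {K : Set (E n)} (hK : K ∈ M.cells) (s : PolyForm n r (k : ℤ)) :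
    cellInner K (timeDeriv J z.u t K).toForm s.toForm =
      cellInner K (z.p t K).toForm s.toForm := by
  classical
  have h := hz.eq_u t ht (Pi.single K s)
  rw [Finset.sum_eq_single_of_mem K hK, Finset.sum_eq_single_of_mem K hK, Pi.single_eq_same] at h
  · exact h
  all_goals
    intro L _ hL
    rw [Pi.single_eq_of_ne hL, PolyForm.toForm_zero, cellInner_zero_right]

/-- Two solutions whose `u`-components vanish at `t` have a symplectic form of zero derivative. -/
lemma hasDerivWithinAt_sympForm_zero {α₀ α₁ : Penalty n}
    {g₁ g₂ : ℝ → (K : Set (E n)) → Lp (Alt n) 2 ((volume : Measure (E n)).restrict K)} {J : Set ℝ}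
    {t₁ t₂ : ℝ} {w₁ w₂ : Fields n r k} (h₁ : SolvesMethod M α₀ α₁ g₁ J t₁ w₁)
    (h₂ : SolvesMethod M α₀ α₁ g₂ J t₂ w₂) {t : ℝ} (ht : t ∈ J) {K : Set (E n)} (hK : K ∈ M.cells)
    (hu₁ : w₁.u t K = 0) (hu₂ : w₂.u t K = 0) :
    HasDerivWithinAt (fun s => sympForm K w₁ w₂ s) 0 J t := by
  let B := (cellForm r (k : ℤ) (M.isCompact_cell K hK)).toContinuousBilinearMap
  -- By the product rule the term with the derivative of p drops out because u = 0 at t, and u̇ may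
  -- be replaced by p. The limit (p, p') is symmetric, so the two halves cancel.
  have key : ∀ {g g' : ℝ → (K : Set (E n)) → Lp (Alt n) 2 ((volume : Measure (E n)).restrict K)}
      {t₀ t₀' : ℝ} {w w' : Fields n r k}, SolvesMethod M α₀ α₁ g J t₀ w →
      SolvesMethod M α₀ α₁ g' J t₀' w' → w.u t K = 0 →
      HasDerivWithinAt (fun s => cellInner K (w.u s K).toForm (w'.p s K).toForm)
        (cellInner K (w.p t K).toForm (w'.p t K).toForm) J t := by
    intro g g' t₀ t₀' w w' hw hw' hu
    have h := B.hasDerivWithinAt_of_bilinear (hw.diff_u K hK t ht).hasDerivWithinAt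
      (hw'.diff_p K hK t ht).hasDerivWithinAt
    rw [hu, map_zero, zero_apply, zero_add] at h
    rw [← hw.cellInner_timeDeriv_u ht hK]
    exact h
  have h := (key h₁ h₂ hu₁).sub (key h₂ h₁ hu₂)
  rw [cellInner_comm K (w₂.p t K).toForm, sub_self] at h
  exact h

/-- The weights `(∑ α)⁻¹`. -/
noncomputable def invWeight (M : PolyhedralMesh n) (α : Penalty n) (e : Set (E n)) : ℝ :=
  (∑ L ∈ M.sides e, α L e)⁻¹

/-- Only facets with two sides constrain the weight; on boundary facets it stays free. -/
lemma isFluxWeight_of_eq_invWeight {α : Penalty n} {j : ℤ} {c : Set (E n) → ℝ}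
    (hc : ∀ e, (M.sides e).card ≠ 1 → c e = invWeight M α e)
    (h : (j < 0 ∨ n ≤ j) ∨ ∀ K ∈ M.cells, ∀ L ∈ M.cells, ∀ e ∈ M.facets K, e ∈ M.facets L →
      α K e + α L e ≠ 0) : IsFluxWeight M c α j := by
  classical
  intro K hK L hL hKL e he heL
  rcases h with h | h
  · exact Or.inr h
  · left
    have hs := M.sides_eq_pair hK hL hKL he heL
    rw [hc e (by rw [hs, Finset.card_pair hKL]; norm_num), invWeight, hs, Finset.sum_pair hKL]
    exact inv_mul_cancel₀ (h K hK L hL e he heL)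

/-- The weights `(∑ α)⁻¹` on interior facets and zero on boundary facets. -/
noncomputable def invWeight₀ (M : PolyhedralMesh n) (α : Penalty n) (e : Set (E n)) : ℝ :=
  if (M.sides e).card = 1 then 0 else invWeight M α e

/-- On an interior facet the other side contributes a positive summand to ∑α. On a boundary facet
1/∑α would give exactly 1 and destroy the strict inequality, which is why the weight 0 is used
there. -/
lemma invWeight₀_mul_lt_one {α : Penalty n} (hα : ∀ K ∈ M.cells, ∀ e ∈ M.facets K, 0 < α K e)
    {K e : Set (E n)} (hK : K ∈ M.cells) (he : e ∈ M.facets K) :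
    invWeight₀ M α e * α K e < 1 := by
  classical
  unfold invWeight₀
  split_ifs with h
  · rw [zero_mul]; exact one_pos
  · have hmem : K ∈ M.sides e := M.mem_sides.2 ⟨hK, he⟩
    obtain ⟨L, hL, hLK⟩ : ∃ L ∈ M.sides e, L ≠ K := by
      by_contra! h'
      exact h (Finset.card_eq_one.2 ⟨K, Finset.eq_singleton_iff_unique_mem.2 ⟨hmem, h'⟩⟩)
    have hlt : α K e < ∑ L ∈ M.sides e, α L e :=
      Finset.single_lt_sum hLK hmem hL (hα L (M.mem_sides.1 hL).1 e (M.mem_sides.1 hL).2)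
        fun A hA _ => (hα A (M.mem_sides.1 hA).1 e (M.mem_sides.1 hA).2).le
    rw [invWeight, inv_mul_lt_one₀ ((hα K hK e he).trans hlt)]
    exact hlt

/-! ### Test traces supported on one facet. -/

section Tests

open scoped Classical in
/-- The trace with the constant value `a` on the facet `e` and zero on all others. -/
noncomputable def singleTan (e : Set (E n)) (a : Alt n) : Trace n :=
  fun _ e' _ => if e' = e then a else 0

open scoped Classical in
/-- The normal trace with the value `a` on the facet `e` of `K`, `-a` on the other side of `e`, and
zero on all other facets. -/
noncomputable def singleNor (K e : Set (E n)) (a : Alt n) : Trace n :=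
  fun L e' _ => if e' = e then (if L = K then a else -a) else 0

variable {K e : Set (E n)} {a : Alt n}

lemma isVhat_singleTan {j : ℤ} (hK : K ∈ M.cells) (he : e ∈ M.facets K) (ha : HasDegree j a)
    (ha' : contract (M.normal K e) a = 0) : M.IsVhat r j (singleTan e a) := by
  refine ⟨fun L hL e' he' => ?_, fun _ _ _ _ _ _ _ _ _ => rfl⟩
  by_cases h : e' = e
  · subst h
    refine ⟨PolyForm.const n r j a, fun x _ => ?_⟩
    simp only [singleTan, if_true]
    exact ⟨(PolyForm.toForm_const ha x).symm, M.contract_normal_eq_zero hL hK he' he ha'⟩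
  · refine ⟨0, fun x _ => ?_⟩
    simp only [singleTan, if_neg h, PolyForm.toForm_zero]
    exact ⟨rfl, (contractL _).map_zero⟩

lemma isL2Trace_singleNor {j : ℤ} (hK : K ∈ M.cells) (he : e ∈ M.facets K) (ha : HasDegree j a)
    (ha' : contract (M.normal K e) a = 0) : M.IsL2Trace j (singleNor K e a) := by
  intro L hL e' he'
  refine ⟨memLp_of_continuous (M.isCompact_facet L hL e' he') (M.facet_measure_ne_top hL he')
    continuous_const, fun x _ => ?_⟩
  simp only [singleNor]
  by_cases h : e' = e
  · subst h
    have h1 := M.contract_normal_eq_zero hL hK he' he ha'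
    have h2 : contract (M.normal L e') (-a) = 0 := by
      rw [← contractL_apply, map_neg, contractL_apply, h1, neg_zero]
    rw [if_pos rfl]
    split_ifs
    · exact ⟨ha, h1⟩
    · exact ⟨ha.neg, h2⟩
  · rw [if_neg h]
    exact ⟨HasDegree.zero _, (contractL _).map_zero⟩

lemma isSingleValuedNor_singleNor (hK : K ∈ M.cells) (he : e ∈ M.facets K) :
    M.IsSingleValuedNor (singleNor K e a) := by
  classical
  intro A hA B hB hAB e' heA heB x _
  simp only [singleNor]
  by_cases h : e' = e
  · subst h
    have h1 : K ∈ M.sides e' := M.mem_sides.2 ⟨hK, he⟩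
    rw [M.sides_eq_pair hA hB hAB heA heB, Finset.mem_insert, Finset.mem_singleton] at h1
    rcases h1 with rfl | rfl
    · simp [hAB.symm]
    · simp [hAB]
  · simp [h]

lemma isVhat_zero (j : ℤ) : M.IsVhat r j 0 :=
  ⟨fun _ _ _ _ => ⟨0, fun _ _ => ⟨by rw [PolyForm.toForm_zero]; rfl, (contractL _).map_zero⟩⟩,
    fun _ _ _ _ _ _ _ _ _ => rfl⟩

lemma isL2Trace_zero (j : ℤ) : M.IsL2Trace j 0 :=
  fun _ _ _ _ => ⟨MemLp.zero, fun _ _ => ⟨HasDegree.zero _, (contractL _).map_zero⟩⟩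

lemma isSingleValuedNor_zero : M.IsSingleValuedNor 0 := fun _ _ _ _ _ _ _ _ _ _ => add_zero _

end Tests

/-- The numerical trace of broken forms that vanish off `K`. -/
lemma flux_single {j j' : ℤ} {c : Set (E n) → ℝ} {α : Penalty n} {K e : Set (E n)}
    (hK : K ∈ M.cells) (he : e ∈ M.facets K) {w : Broken n r j} {q : Broken n r j'}
    (hw : ∀ L ∈ M.cells, L ≠ K → w L = 0) (hq : ∀ L ∈ M.cells, L ≠ K → q L = 0) (x : E n) :
    flux M c α r j j' e (w, q) x = c e • (α K e • M.tan w K e x + M.nor q K e x) := by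
  rw [flux_apply, Finset.sum_eq_single_of_mem K (M.mem_sides.2 ⟨hK, he⟩)]
  intro L hL hLK
  have h1 : M.tan w L e x = 0 := by
    simp only [PolyhedralMesh.tan, hw L (M.mem_sides.1 hL).1 hLK, PolyForm.toForm_zero]
    exact (tanTrL _).map_zero
  have h2 : M.nor q L e x = 0 := by
    simp only [PolyhedralMesh.nor, hq L (M.mem_sides.1 hL).1 hLK, PolyForm.toForm_zero]
    exact (contractL _).map_zero
  rw [h1, h2, smul_zero, add_zero]

variable {α₀ α₁ : Penalty n} {I J : Set ℝ} {f : Source n r k} {t₀ : ℝ} {z : Fields n r k}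

lemma IsSolution.continuousOn_u (hz : IsSolution M α₀ α₁ f J t₀ z) {K : Set (E n)}
    (hK : K ∈ M.cells) : ContinuousOn (fun t => z.u t K) J :=
  fun t ht => (hz.diff_u K hK t ht).continuousWithinAt

/-- A multisymplectic method annihilates the brackets of the numerical traces of first variations
whose `u`-components vanish. -/
lemma IsMultisymplectic.hatBracket_eq_zero (h : IsMultisymplectic M α₀ α₁ f J t₀)
    (hf : f.IsAdmissible M I) (hJI : J ⊆ I) (hJ : J.OrdConnected) (hJ' : J.Nontrivial)
    (ht₀ : t₀ ∈ J) (hz : IsSolution M α₀ α₁ f J t₀ z) {w₁ w₂ : Fields n r k}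
    (h₁ : IsFirstVariation M α₀ α₁ f J t₀ z w₁) (h₂ : IsFirstVariation M α₀ α₁ f J t₀ z w₂)
    {K : Set (E n)} (hK : K ∈ M.cells) (hu₁ : w₁.u t₀ K = 0) (hu₂ : w₂.u t₀ K = 0) :
    hatBracket M α₁ K w₁ w₂ t₀ = 0 := by
  have hd := h z hz (fun L hL t ht => hf.symm L hL t (hJI ht) _) w₁ w₂ h₁ h₂ K hK t₀ ht₀
  have h0 := hasDerivWithinAt_sympForm_zero h₁ h₂ ht₀ hK hu₁ hu₂
  have hud := uniqueDiffOn_of_ordConnected hJ hJ' t₀ ht₀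
  have := hd.derivWithin hud
  rw [h0.derivWithin hud] at this
  exact neg_eq_zero.1 this.symm

/-- Below top degree the jumps of `p̂^tan` violate the conservation law. -/
lemma not_isMultisymplectic_of_lt (hn : 1 ≤ n) (hk : k < n)
    (hc₀ : IsFluxWeight M (invWeight M α₀) α₀ ((k : ℤ) - 1))
    (hα₁ : ∀ K ∈ M.cells, ∀ e ∈ M.facets K, 0 < α₁ K e)
    (hf : f.IsAdmissible M I) (hJI : J ⊆ I) (hJ : J.OrdConnected) (hJ' : J.Nontrivial)
    (ht₀ : t₀ ∈ J) (hz : IsSolution M α₀ α₁ f J t₀ z) :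
    ¬ IsMultisymplectic M α₀ α₁ f J t₀ := by
  classical
  intro hms
  obtain ⟨d, ⟨Θ⟩⟩ := exists_parametrization M r k
  obtain ⟨K, hK⟩ := M.cells_nonempty
  obtain ⟨e, he⟩ := M.exists_facet hn hK
  obtain ⟨b, hb, hb0⟩ := exists_tanTr_ne_zero (M.normal_ne_zero hK he) hk
  set a := tanTr (M.normal K e) b
  have hc₁ : IsFluxWeight M (invWeight₀ M α₁) α₁ (k : ℤ) :=
    isFluxWeight_of_eq_invWeight (fun e h => if_neg h) (Or.inr fun K hK L hL e he he' =>
      (add_pos (hα₁ K hK e he) (hα₁ L hL e he')).ne')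
  have hzc := fun K (hK : K ∈ M.cells) => hz.continuousOn_u hK
  obtain ⟨w₁, hw₁, hu₁, hp₁, hut₁, hun₁, -, -, -, -⟩ := exists_firstVariation Θ hc₀ hc₁ hf hJI hJ hJ'
    ht₀ hzc 0 (isVhat_singleTan hK he (hb.tanTr _) (contract_tanTr _ _) :
      M.IsVhat r (k : ℤ) (singleTan e a)) (fun _ _ => continuous_const) (isL2Trace_zero _)
    (fun _ _ => continuous_const) isSingleValuedNor_zero
  obtain ⟨w₂, hw₂, hu₂, hp₂, hut₂, hun₂, -, hph₂, -, hρ₂⟩ := exists_firstVariation Θ hc₀ hc₁ hf hJI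
    hJ hJ' ht₀ hzc (Pi.single K (PolyForm.const n r k b)) (isVhat_zero _)
    (fun _ _ => continuous_const) (isL2Trace_zero _)
    (fun _ _ => continuous_const) isSingleValuedNor_zero
  have h0 := hms.hatBracket_eq_zero hf hJI hJ hJ' ht₀ hz hw₁ hw₂ hK (hu₁ K hK) (hu₂ K hK)
  have hp₂' : ∀ L ∈ M.cells, L ≠ K → w₂.p t₀ L = 0 := fun L hL hLK => by
    rw [hp₂ L hL, Pi.single_eq_of_ne hLK]
  have htan : ∀ x, M.tan (w₂.p t₀) K e x = a := by
    intro x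
    simp only [PolyhedralMesh.tan]
    rw [hp₂ K hK, Pi.single_eq_same, PolyForm.toForm_const hb]
  have hnor : ∀ x, M.nor (w₂.ρ t₀) K e x = 0 := by
    intro x
    simp only [PolyhedralMesh.nor]
    rw [hρ₂ rfl K hK, PolyForm.toForm_zero]
    exact (contractL _).map_zero
  -- Here ρ₂ = 0 and only K contributes to p̂₂^tan = cα a, so ρ̂₂^nor = -α(cα a - a).
  have hval : ∀ x, w₂.rhohatNor M α₁ t₀ K e x =
      (α₁ K e * (1 - invWeight₀ M α₁ e * α₁ K e)) • a := by
    intro x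
    have h1 : w₂.rhohatNor M α₁ t₀ K e x = M.nor (w₂.ρ t₀) K e x -
        α₁ K e • (w₂.phatTan t₀ K e x - M.tan (w₂.p t₀) K e x) := rfl
    rw [h1, hph₂]
    dsimp only
    rw [flux_single hK he hp₂' (fun L hL _ => hρ₂ rfl L hL), hnor, htan]
    module
  have hθ := invWeight₀_mul_lt_one hα₁ hK he
  -- Three of the four terms contain a vanishing û; ⟨û₁^tan, ρ̂₂^nor⟩ is left.
  rw [hatBracket, hut₁, hun₁, hut₂, hun₂, M.bdryInner_zero_left, M.bdryInner_zero_right,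
    M.bdryInner_zero_right, M.bdryInner_single hK he
      (c := α₁ K e * (1 - invWeight₀ M α₁ e * α₁ K e) * ‖a‖ ^ 2)] at h0
  · have h1 := M.facet_measure_toReal_pos hK he
    have h2 := hα₁ K hK e he
    have h3 : 0 < 1 - invWeight₀ M α₁ e * α₁ K e := by linarith
    have h4 : 0 < ‖a‖ := norm_pos_iff.2 hb0
    have h5 : 0 < (Measure.euclideanHausdorffMeasure (n - 1) e).toReal *
      (α₁ K e * (1 - invWeight₀ M α₁ e * α₁ K e) * ‖a‖ ^ 2) := by positivity
    linarith
  · intro x _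
    rw [hval x, real_inner_smul_right]
    simp [singleTan]
  · intro e' _ hne x _
    simp [singleTan, hne]

/-- In positive degree the numerical traces `σ̂^tan` violate the conservation law. -/
lemma not_isMultisymplectic_of_pos (hn : 1 ≤ n) (hk : 1 ≤ k) (hkn : k ≤ n)
    (hα₀ : ∀ K ∈ M.cells, ∀ e ∈ M.facets K, α₀ K e < 0)
    (hc₁ : IsFluxWeight M (invWeight₀ M α₁) α₁ (k : ℤ))
    (hf : f.IsAdmissible M I) (hJI : J ⊆ I) (hJ : J.OrdConnected) (hJ' : J.Nontrivial)
    (ht₀ : t₀ ∈ J) (hz : IsSolution M α₀ α₁ f J t₀ z) :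
    ¬ IsMultisymplectic M α₀ α₁ f J t₀ := by
  classical
  intro hms
  obtain ⟨d, ⟨Θ⟩⟩ := exists_parametrization M r k
  obtain ⟨K, hK⟩ := M.cells_nonempty
  obtain ⟨e, he⟩ := M.exists_facet hn hK
  obtain ⟨b, hb, hb0⟩ := exists_norTr_ne_zero (M.normal_ne_zero hK he) (j := k - 1) (by omega)
  have hb : HasDegree (k : ℤ) b := by
    rwa [Nat.cast_sub hk, Nat.cast_one, sub_add_cancel] at hb
  set a := norTr (M.normal K e) b
  have hc₀ : IsFluxWeight M (invWeight M α₀) α₀ ((k : ℤ) - 1) :=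
    isFluxWeight_of_eq_invWeight (fun e _ => rfl) (Or.inr fun K hK L hL e he he' =>
      (add_neg (hα₀ K hK e he) (hα₀ L hL e he')).ne)
  -- Unlike the weight for p̂^tan in the case k < n, this one must not vanish on boundary facets:
  -- the surviving bracket term is proportional to it.
  have hsum : invWeight M α₀ e ≠ 0 := by
    refine inv_ne_zero (Finset.sum_neg (fun L hL => hα₀ L (M.mem_sides.1 hL).1 e
      (M.mem_sides.1 hL).2) ⟨K, M.mem_sides.2 ⟨hK, he⟩⟩).ne
  have hzc := fun K (hK : K ∈ M.cells) => hz.continuousOn_u hK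
  obtain ⟨w₁, hw₁, hu₁, hp₁, hut₁, hun₁, -, -, -, -⟩ := exists_firstVariation Θ hc₀ hc₁ hf hJI hJ hJ'
    ht₀ hzc 0 (isVhat_zero _) (fun _ _ => continuous_const)
    (isL2Trace_singleNor hK he (hb.contract _) (contract_contract _ _) :
      M.IsL2Trace ((k : ℤ) - 1) (singleNor K e a)) (fun _ _ => continuous_const)
    (isSingleValuedNor_singleNor hK he)
  obtain ⟨w₂, hw₂, hu₂, hp₂, hut₂, hun₂, hsh₂, -, hσ₂, -⟩ := exists_firstVariation Θ hc₀ hc₁ hf hJI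
    hJ hJ' ht₀ hzc (Pi.single K (PolyForm.const n r k b)) (isVhat_zero _)
    (fun _ _ => continuous_const) (isL2Trace_zero _)
    (fun _ _ => continuous_const) isSingleValuedNor_zero
  have h0 := hms.hatBracket_eq_zero hf hJI hJ hJ' ht₀ hz hw₁ hw₂ hK (hu₁ K hK) (hu₂ K hK)
  have hp₂' : ∀ L ∈ M.cells, L ≠ K → w₂.p t₀ L = 0 := fun L hL hLK => by
    rw [hp₂ L hL, Pi.single_eq_of_ne hLK]
  have htan : ∀ x, M.tan (w₂.σ t₀) K e x = 0 := by
    intro x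
    simp only [PolyhedralMesh.tan]
    rw [hσ₂ rfl K hK, PolyForm.toForm_zero]
    exact (tanTrL _).map_zero
  have hnor : ∀ x, M.nor (w₂.p t₀) K e x = a := by
    intro x
    simp only [PolyhedralMesh.nor]
    rw [hp₂ K hK, Pi.single_eq_same, PolyForm.toForm_const hb]
  have hval : ∀ x, w₂.sigmahatTan t₀ K e x = invWeight M α₀ e • a := by
    intro x
    rw [hsh₂]
    dsimp only
    rw [flux_single hK he (fun L hL _ => hσ₂ rfl L hL) hp₂', hnor, htan, smul_zero, zero_add]
  rw [hatBracket, hut₁, hun₁, hut₂, hun₂, M.bdryInner_zero_left, M.bdryInner_zero_left,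
    M.bdryInner_zero_right, M.bdryInner_single hK he (c := invWeight M α₀ e * ‖a‖ ^ 2)] at h0
  · have h1 := (M.facet_measure_toReal_pos hK he).ne'
    have h4 : ‖a‖ ≠ 0 := norm_ne_zero_iff.2 hb0
    have h5 : (Measure.euclideanHausdorffMeasure (n - 1) e).toReal *
      (invWeight M α₀ e * ‖a‖ ^ 2) ≠ 0 := by positivity
    exact h5 (by linarith)
  · intro x _
    rw [hval x, real_inner_smul_left]
    simp [singleNor]
  · intro e' _ hne x _
    simp [singleNor, hne]

end Failure

end HodgeLDG

open HodgeLDG in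
theorem mainTheorem7 (n : ℕ) (hn : 1 ≤ n) (k : ℕ) (hk : k ≤ n) (r : ℕ)
    (M : PolyhedralMesh n) (α₀ α₁ : Penalty n)
    (hα₀ : α₀.IsNegDef M ((k : ℤ) - 1)) (hα₁ : α₁.IsPosDef M (k : ℤ))
    (I : Set ℝ) (hI : I.OrdConnected) (hI' : I.Nontrivial)
    (f : Source n r k) (hf : f.IsAdmissible M I) :
    (∀ J : Set ℝ, J ⊆ I → J.OrdConnected → J.Nontrivial → ∀ t₀ ∈ J,
      (∃ z : Fields n r k, IsSolution M α₀ α₁ f J t₀ z) →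
        ¬ IsMultisymplectic M α₀ α₁ f J t₀) ∧
    (∀ t₀ ∈ I, ∃ J : Set ℝ, J ⊆ I ∧ J.OrdConnected ∧ J ∈ nhdsWithin t₀ I ∧
      ∃ z : Fields n r k, IsSolution M α₀ α₁ f J t₀ z) := by
  have hneg : 1 ≤ k → ∀ K ∈ M.cells, ∀ e ∈ M.facets K, α₀ K e < 0 := fun h1 K hK e he =>
    Penalty.IsNegDef.neg M (j := k - 1) (by omega) (by rwa [Nat.cast_sub h1, Nat.cast_one]) hK he
  have hpos : k < n → ∀ K ∈ M.cells, ∀ e ∈ M.facets K, 0 < α₁ K e := fun h1 K hK e he =>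
    Penalty.IsPosDef.pos M h1 hα₁ hK he
  have hc₀ : IsFluxWeight M (invWeight M α₀) α₀ ((k : ℤ) - 1) := by
    refine isFluxWeight_of_eq_invWeight (fun _ _ => rfl) ?_
    rcases Nat.eq_zero_or_pos k with h0 | h1
    -- For k = 0 definiteness in degree -1 is vacuous, and so is the requirement on the weight.
    · exact .inl (.inl (by omega))
    · exact .inr fun K hK L hL e he heL =>
        (add_neg (hneg h1 K hK e he) (hneg h1 L hL e heL)).ne
  have hc₁ : IsFluxWeight M (invWeight₀ M α₁) α₁ k := by
    refine isFluxWeight_of_eq_invWeight (fun e h => if_neg h) ?_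
    rcases hk.lt_or_eq with h1 | h1
    · exact .inr fun K hK L hL e he heL =>
        (add_pos (hpos h1 K hK e he) (hpos h1 L hL e heL)).ne'
    · exact .inl (.inr (by omega))
  refine ⟨fun J hJI hJ hJ' t₀ ht₀ ⟨z, hz⟩ => ?_, fun t₀ ht₀ => ?_⟩
  · rcases hk.lt_or_eq with h1 | h1
    · exact not_isMultisymplectic_of_lt hn h1 hc₀ (hpos h1) hf hJI hJ hJ' ht₀ hz
    -- Here k = n ≥ 1, so α^{k-1} acts in degree n - 1, where its sign is known.
    · exact not_isMultisymplectic_of_pos hn (by omega) hk (hneg (by omega)) hc₁ hf hJI hJ hJ' ht₀ hz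
  · obtain ⟨d, ⟨Θ⟩⟩ := exists_parametrization M r k
    obtain ⟨J, h1, h2, h3, h4⟩ := exists_solution Θ hc₀ hc₁ hI hI' hf ht₀
    exact ⟨J, h1, h2, h3, h4⟩
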